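/- Let $N\ge 1$, $p>1$, and let $K\subset\mathbb R^N$ be a bounded convex symmetric set ($-K=K$) having the origin in its interior; let $\|x\|_K=\inf\{\lambda>0:\ x/\lambda\in K\}$ be the norm with unit ball $K$. For $z\in\mathbb C$ put $|z|_p=(|\Re z|^p+|\Im z|^p)^{1/p}$, and for $v\in\mathbb C^N$ put $$\|v\|_{Z_p^*K}=\Big(\frac{N+p}{p}\int_K |v\cdot x|_p^p\,dx\Big)^{1/p},\qquad v\cdot x=\sum_{j=1}^N v_jx_j .$$ Let $A:\mathbb R^N\to\mathbb R^N$ be Lipschitz, and let $W^{1,p}_{A,K}(\mathbb R^N)$ be the space of all $u\in L^p(\mathbb R^N,\mathbb C)$ that have a weak gradient $\nabla u\in L^1_{\rm loc}(\mathbb R^N,\mathbb C^N)$ with $\int_{\mathbb R^N}\|\nabla u-iA(x)u\|_{Z_p^*K}^p\,dx<\infty$. For $u:\mathbb R^N\to\mathbb C$ set $$\Psi_u(x,y)=e^{i(x-y)\cdot A\left(\frac{x+y}{2}\right)}u(y),\qquad x,y\in\mathbb R^N .$$ Then, for every $u\in W^{1,p}_{A,K}(\mathbb R^N)$, $$\lim_{\delta\searrow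 0}\int_{\mathbb R^N}\int_{\mathbb R^N}\frac{\delta^p}{\|x-y\|_K^{N+p}}\,\mathbf 1_{\{|\Psi_u(x,y)-\Psi_u(x,x)|_p>\delta\}}\,dx\,dy=\int_{\mathbb R^N}\|\nabla u-iA(x)u\|_{Z_p^*K}^p\,dx .$$ -/

import Mathlib

open MeasureTheory Filter Topology

noncomputable section

namespace AnisoMagnetic

/-- Euclidean space `ℝ^N`. -/
abbrev RN (N : ℕ) : Type := EuclideanSpace ℝ (Fin N)

/-- The space `ℂ^N`. -/
abbrev CN (N : ℕ) : Type := EuclideanSpace ℂ (Fin N)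

/-- `K` is the unit ball of a norm on `ℝ^N`: it is convex, symmetric, bounded, and the origin is an
interior point. The norm itself is `gauge K`, the Minkowski functional
`x ↦ inf {r > 0 | r⁻¹ • x ∈ K}`. Neither openness nor closedness of `K` is imposed. -/
structure IsNormUnitBall {N : ℕ} (K : Set (RN N)) : Prop where
  convex : Convex ℝ K
  symmetric : ∀ x ∈ K, -x ∈ K
  zero_mem_interior : (0 : RN N) ∈ interior K
  bounded : Bornology.IsBounded K

/-- `|z|_p = (|Re z|^p + |Im z|^p)^{1/p}` for a complex number `z`. -/
def absP (p : ℝ) (z : ℂ) : ℝ := (|z.re| ^ p + |z.im| ^ p) ^ (1 / p)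

/-- The bilinear product `v · x = ∑ j, v_j x_j` of `v ∈ ℂ^N` and `x ∈ ℝ^N`. -/
def cdot {N : ℕ} (v : CN N) (x : RN N) : ℂ := ∑ j, v j * (x j : ℂ)

/-- `‖v‖_{Z_p^*K} = ((N + p) / p * ∫_K |v · x|_p^p dx)^{1/p}`, the norm of the complex polar
`L_p`-moment body of `K`. -/
def momentNorm {N : ℕ} (p : ℝ) (K : Set (RN N)) (v : CN N) : ℝ :=
  (((N : ℝ) + p) / p * ∫ x in K, absP p (cdot v x) ^ p) ^ (1 / p)

/-- `G` is the weak (distributional) gradient of `u : ℝ^N → ℂ`. -/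
structure IsWeakGradient {N : ℕ} (u : RN N → ℂ) (G : RN N → CN N) : Prop where
  locallyIntegrable : LocallyIntegrable u volume
  locallyIntegrable_grad : LocallyIntegrable G volume
  integral_eq : ∀ φ : RN N → ℝ, ContDiff ℝ ((⊤ : ℕ∞) : WithTop ℕ∞) φ → HasCompactSupport φ →
    ∀ j : Fin N,
      ∫ x, ((fderiv ℝ φ x (EuclideanSpace.single j 1) : ℝ) : ℂ) * u x
        = -∫ x, ((φ x : ℝ) : ℂ) * G x j

/-- The magnetic gradient `∇u - i A u`, where `G` plays the role of `∇u`. -/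
def magGrad {N : ℕ} (A : RN N → RN N) (u : RN N → ℂ) (G : RN N → CN N) (x : RN N) : CN N :=
  WithLp.toLp 2 fun j => G x j - Complex.I * ((A x j : ℝ) : ℂ) * u x

/-- `∫ ‖∇u - i A u‖_{Z_p^*K}^p dx`, with values in `[0, ∞]`. -/
def magEnergy {N : ℕ} (p : ℝ) (K : Set (RN N)) (A : RN N → RN N) (u : RN N → ℂ)
    (G : RN N → CN N) : ENNReal :=
  ∫⁻ x, ENNReal.ofReal (momentNorm p K (magGrad A u G x) ^ p)

/-- Membership in the anisotropic magnetic Sobolev space `W^{1,p}_{A,K}(ℝ^N)`: `u ∈ L^p`, and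
`u` has a weak gradient for which `∫ ‖∇u - i A u‖_{Z_p^*K}^p dx` is finite. As `|·|_p` and the
modulus are equivalent norms on `ℂ`, they define the same space `L^p`. -/
structure MemMagSobolev {N : ℕ} (p : ℝ) (K : Set (RN N)) (A : RN N → RN N) (u : RN N → ℂ) :
    Prop where
  memLp : MemLp u (ENNReal.ofReal p) volume
  exists_grad : ∃ G : RN N → CN N, IsWeakGradient u G ∧ magEnergy p K A u G < ⊤

/-- `Ψ_u(x, y) = e^{i (x - y) · A((x + y) / 2)} u(y)`. -/
def Psi {N : ℕ} (A : RN N → RN N) (u : RN N → ℂ) (x y : RN N) : ℂ :=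
  Complex.exp (Complex.I * ((inner ℝ (x - y) (A ((1 / 2 : ℝ) • (x + y))) : ℝ) : ℂ)) * u y

/-- The nonlocal functional
`∬ δ^p / ‖x - y‖_K^{N+p} 1_{|Ψ_u(x,y) - Ψ_u(x,x)|_p > δ} dx dy`, with values in `[0, ∞]`.
For `δ > 0` the diagonal `x = y` is not in the set of integration. -/
def nonlocalFunctional {N : ℕ} (p : ℝ) (K : Set (RN N)) (A : RN N → RN N) (u : RN N → ℂ)
    (δ : ℝ) : ENNReal :=
  ∫⁻ z : RN N × RN N,
    Set.indicator {w : RN N × RN N | δ < absP p (Psi A u w.1 w.2 - Psi A u w.1 w.1)}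
      (fun w => ENNReal.ofReal (δ ^ p / gauge K (w.1 - w.2) ^ ((N : ℝ) + p))) z

end AnisoMagnetic

end

/-!
Write `y = x + z` and substitute `z = δ w`. Since `‖·‖_K^{-(N+p)}` is homogeneous, the functional
becomes `∫ ‖w‖_K^{-(N+p)} |{x : |Ψ_u(x, x + δ w) - Ψ_u(x, x)|_p > δ}| dw`. Along almost every line
`u` is absolutely continuous and `δ⁻¹ (Ψ_u(x, x + δ w) - Ψ_u(x, x))` is an average over the segment
from `x` to `x + δ w`, up to a small error, of `V · w` with `V = ∇u - i A u`. Hence it converges to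
`V · w` in `L^p`, and the inner measure converges to `|{x : |V(x) · w|_p > 1}|` as soon as the level
`1` is not charged, which by homogeneity in `w` is the case for almost every `w`. Fubini and
integration in the radial direction identify the limit: `∫ ‖w‖_K^{-(N+p)} 1_{|v · w|_p > 1} dw` is
`(N + p) / p * ∫_K |v · x|_p^p dx`.

For the domination, let `F = 4 (|V| + (L + 1) |u|)`. If the average of `|w| F` over a segment
exceeds `2`, then the average of its part above the level `1` exceeds `1`. By Markov's inequality
and translation invariance the inner measure is therefore at most
`2 * ∫ |w| F(x) 1_{|w| F(x) > 1} dx`, uniformly in `δ`. The weight `‖w‖_K^{-(N+p)}` integrates this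
to a multiple of `∫ F^p`, because `p > 1`.
-/

noncomputable section

namespace AnisoMagnetic

open scoped ENNReal

section LpTools

variable {α β : Type*} [MeasurableSpace α] [MeasurableSpace β] {μ : Measure α} {q : ℝ≥0∞}

theorem eLpNorm_lintegral_le [SFinite μ] {ν : Measure β} [IsProbabilityMeasure ν]
    {f : α → β → ℝ≥0∞} (hf : AEMeasurable (Function.uncurry f) (μ.prod ν)) (hq : 1 ≤ q)
    (hq_top : q ≠ ⊤) {C : ℝ≥0∞} (hC : ∀ᵐ t ∂ν, eLpNorm (f · t) q μ ≤ C) :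
    eLpNorm (fun x => ∫⁻ t, f x t ∂ν) q μ ≤ C := by
  have hq0 : q ≠ 0 := (zero_lt_one.trans_le hq).ne'
  have hq_pos : 0 < q.toReal := ENNReal.toReal_pos hq0 hq_top
  have jensen : ∀ᵐ x ∂μ, (∫⁻ t, f x t ∂ν) ^ q.toReal ≤ ∫⁻ t, f x t ^ q.toReal ∂ν := by
    filter_upwards [hf.aestronglyMeasurable.prodMk_left] with x hx
    have h := eLpNorm_le_eLpNorm_of_exponent_le (μ := ν) (f := f x) hq hx
    rw [eLpNorm_one_eq_lintegral_enorm,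
      eLpNorm_eq_lintegral_rpow_enorm_toReal hq0 hq_top] at h
    simpa only [enorm_eq_self, one_div, ENNReal.le_rpow_inv_iff hq_pos] using h
  have slice : ∀ᵐ t ∂ν, ∫⁻ x, f x t ^ q.toReal ∂μ ≤ C ^ q.toReal := by
    filter_upwards [hC] with t ht
    rwa [eLpNorm_eq_lintegral_rpow_enorm_toReal hq0 hq_top, one_div,
      ENNReal.rpow_inv_le_iff hq_pos] at ht
  rw [eLpNorm_eq_lintegral_rpow_enorm_toReal hq0 hq_top, one_div, ENNReal.rpow_inv_le_iff hq_pos]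
  calc ∫⁻ x, (∫⁻ t, f x t ∂ν) ^ q.toReal ∂μ
      ≤ ∫⁻ x, ∫⁻ t, f x t ^ q.toReal ∂ν ∂μ := lintegral_mono_ae jensen
    _ = ∫⁻ t, ∫⁻ x, f x t ^ q.toReal ∂μ ∂ν :=
        lintegral_lintegral_swap (hf.pow_const _)
    _ ≤ ∫⁻ _, C ^ q.toReal ∂ν := lintegral_mono_ae slice
    _ = C ^ q.toReal := by simp

theorem tendsto_eLpNorm_comp_add_sub {E F : Type*} [NormedAddCommGroup E] [LocallyCompactSpace E]
    [MeasurableSpace E] [BorelSpace E] {μ : Measure E} [μ.IsAddHaarMeasure] [μ.Regular]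
    [NormedAddCommGroup F] {V : E → F} (hV : MemLp V q μ) (hq : 1 ≤ q) (hq_top : q ≠ ⊤) :
    Tendsto (fun h => eLpNorm (fun x => V (x + h) - V x) q μ) (𝓝 0) (𝓝 0) := by
  have : Fact (1 ≤ q) := ⟨hq⟩
  let g : C(E, C(E, E)) := ContinuousMap.curry ⟨fun z : E × E => z.2 + z.1, by fun_prop⟩
  have hg (h : E) : MeasurePreserving (g h) μ μ := measurePreserving_add_right μ h
  have translate_ae (h : E) :
      Lp.compMeasurePreserving (g h) (hg h) (hV.toLp V) =ᵐ[μ] fun x => V (x + h) :=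
    (Lp.coeFn_compMeasurePreserving _ (hg h)).trans
      ((hg h).quasiMeasurePreserving.ae_eq_comp hV.coeFn_toLp)
  have hc : Continuous fun h => Lp.compMeasurePreserving (g h) (hg h) (hV.toLp V) :=
    continuous_const.compMeasurePreservingLp g.continuous hg hq_top
  refine (tendsto_iff_edist_tendsto_0.1 (hc.tendsto 0)).congr fun h => ?_
  rw [Lp.edist_def, eLpNorm_congr_ae ((translate_ae h).sub (translate_ae 0))]
  simp only [add_zero, Pi.sub_def]

theorem tendsto_eLpNorm_smul_zero {ι F : Type*} {l : Filter ι} [l.IsCountablyGenerated]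
    [NormedAddCommGroup F] [NormedSpace ℝ F] {V : α → F} {c : ι → α → ℝ} (hV : MemLp V q μ)
    (hq_top : q ≠ ⊤) (hc : ∀ i, AEStronglyMeasurable (c i) μ) {C : ℝ}
    (hC : ∀ i, ∀ᵐ x ∂μ, ‖c i x‖ ≤ C) (hlim : ∀ᵐ x ∂μ, Tendsto (c · x) l (𝓝 0)) :
    Tendsto (fun i => eLpNorm (fun x => c i x • V x) q μ) l (𝓝 0) := by
  rcases eq_or_ne q 0 with rfl | hq0
  · simp [tendsto_const_nhds]
  have hq_pos : 0 < q.toReal := ENNReal.toReal_pos hq0 hq_top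
  have hpow : Tendsto (fun i => ∫⁻ x, ‖c i x • V x‖ₑ ^ q.toReal ∂μ) l (𝓝 (∫⁻ _, 0 ∂μ)) := by
    refine tendsto_lintegral_filter_of_dominated_convergence' (fun x => ‖C • V x‖ₑ ^ q.toReal)
      (.of_forall fun i => ((hc i).smul hV.1).enorm.pow_const _) (.of_forall fun i => ?_)
      (lintegral_rpow_enorm_lt_top_of_eLpNorm_lt_top hq0 hq_top (hV.const_smul C).2).ne ?_
    · filter_upwards [hC i] with x hx
      gcongr
      rw [enorm_le_iff_norm_le, norm_smul, norm_smul]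
      gcongr
      exact hx.trans (le_abs_self C)
    · filter_upwards [hlim] with x hx
      simpa [hq_pos, Function.comp_def] using
        ((ENNReal.continuous_rpow_const (y := q.toReal)).tendsto _).comp (hx.smul_const (V x)).enorm
  simp only [eLpNorm_eq_lintegral_rpow_enorm_toReal hq0 hq_top]
  simpa [hq_pos, Function.comp_def] using
    ((ENNReal.continuous_rpow_const (y := 1 / q.toReal)).tendsto _).comp hpow

theorem tendsto_measure_abs_sub_le {g : α → ℝ} (hg : AEMeasurable g μ) {a c : ℝ} (hca : c < a)
    (hfin : μ {x | c < g x} ≠ ⊤) :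
    Tendsto (fun r => μ {x | |g x - a| ≤ r}) (𝓝[>] 0) (𝓝 (μ {x | g x = a})) := by
  have hInter : ⋂ r > (0 : ℝ), {x | |g x - a| ≤ r} = {x | g x = a} := by
    ext x
    simp only [Set.mem_iInter, Set.mem_ofPred_eq, ← sub_eq_zero (a := g x), ← abs_nonpos_iff]
    exact forall_gt_imp_ge_iff_le_of_dense
  rw [← hInter]
  refine tendsto_measure_biInter_gt (fun r _ => ?_) (fun i j _ hij x hx => le_trans hx hij)
    ⟨(a - c) / 2, half_pos (sub_pos.2 hca),
      ne_top_of_le_ne_top hfin (measure_mono fun x hx => ?_)⟩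
  · exact nullMeasurableSet_le (by fun_prop) aemeasurable_const
  · have := abs_le.1 (Set.mem_ofPred_eq ▸ hx)
    simp only [Set.mem_ofPred_eq]
    linarith

theorem tendsto_measure_lt_of_tendstoInMeasure {ι : Type*} {l : Filter ι} {f : ι → α → ℝ}
    {g : α → ℝ} (hfg : TendstoInMeasure μ f l g) (hg : AEMeasurable g μ) {a c : ℝ} (hca : c < a)
    (hfin : μ {x | c < g x} ≠ ⊤) (hlevel : μ {x | g x = a} = 0) :
    Tendsto (fun i => μ {x | a < f i x}) l (𝓝 (μ {x | a < g x})) := by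
  have hball := hlevel ▸ tendsto_measure_abs_sub_le hg hca hfin
  have htop : μ {x | a < g x} ≠ ⊤ :=
    ne_top_of_le_ne_top hfin (measure_mono fun x hx => hca.trans hx)
  rw [ENNReal.tendsto_nhds htop]
  intro ε hε
  obtain ⟨r, hrε, hr⟩ : ∃ r, μ {x | |g x - a| ≤ r} ≤ ε / 2 ∧ r ∈ Set.Ioi 0 :=
    ((ENNReal.tendsto_nhds_zero.1 hball (ε / 2) (ENNReal.half_pos hε.ne')).and
      self_mem_nhdsWithin).exists
  filter_upwards [ENNReal.tendsto_nhds_zero.1 (tendstoInMeasure_iff_norm.1 hfg r hr) (ε / 2)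
    (ENNReal.half_pos hε.ne')] with i hi
  have hbad : μ ({x | r ≤ ‖f i x - g x‖} ∪ {x | |g x - a| ≤ r}) ≤ ε :=
    (measure_union_le _ _).trans ((add_le_add hi hrε).trans (ENNReal.add_halves ε).le)
  have hdiff (x : α) (h : ¬(a < f i x ↔ a < g x)) :
      r ≤ ‖f i x - g x‖ ∨ |g x - a| ≤ r := by
    rw [Real.norm_eq_abs]
    grind
  rw [Set.mem_Icc, tsub_le_iff_right]
  constructor
  · refine (measure_mono fun x hx => ?_).trans
      ((measure_union_le _ _).trans (add_le_add_right hbad _))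
    exact or_iff_not_imp_left.2 fun h => hdiff x fun h' => h (h'.2 hx)
  · refine (measure_mono fun x hx => ?_).trans
      ((measure_union_le _ _).trans (add_le_add_right hbad _))
    exact or_iff_not_imp_left.2 fun h => hdiff x fun h' => h (h'.1 hx)

end LpTools

section GaugeKernel

open Module

variable {E : Type*} [NormedAddCommGroup E] [NormedSpace ℝ E] {K : Set E} {p : ℝ}

/-- The singular kernel `‖z‖_K^{-(n + p)}` on an `n`-dimensional space, where `‖·‖_K` is the gauge
of `K`. At the origin it has the value `0` rather than `∞`, which is harmless because it is only
integrated over sets whose slices omit the origin. -/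
def gaugeKernel (p : ℝ) (K : Set E) (z : E) : ℝ≥0∞ :=
  ENNReal.ofReal ((gauge K z)⁻¹ ^ ((finrank ℝ E : ℝ) + p))

/-- `a` if `a > 1` and `0` otherwise: the part of a nonnegative function above the level `1`, whose
integral bounds the measure of the superlevel set by Markov's inequality. -/
def aboveOne (a : ℝ≥0∞) : ℝ≥0∞ := (Set.Ioi 1).indicator id a

theorem measurable_aboveOne : Measurable aboveOne := measurable_id.indicator measurableSet_Ioi

theorem le_one_add_aboveOne (a : ℝ≥0∞) : a ≤ 1 + aboveOne a := by
  by_cases ha : a ∈ Set.Ioi 1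
  · simp [aboveOne, ha]
  · exact (not_lt.1 ha).trans le_self_add

theorem measure_two_lt_lintegral_le {α β : Type*} [MeasurableSpace α] [MeasurableSpace β]
    {μ : Measure α} [SFinite μ] {ν : Measure β} [IsProbabilityMeasure ν] {f : α → β → ℝ≥0∞}
    (hf : AEMeasurable (Function.uncurry f) (μ.prod ν)) :
    μ {x | 2 < ∫⁻ t, f x t ∂ν} ≤ ∫⁻ t, ∫⁻ x, aboveOne (f x t) ∂μ ∂ν := by
  have hm : AEMeasurable (Function.uncurry fun x t => aboveOne (f x t)) (μ.prod ν) :=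
    measurable_aboveOne.comp_aemeasurable hf
  have hsub (x : α) (hx : 2 < ∫⁻ t, f x t ∂ν) : 1 ≤ ∫⁻ t, aboveOne (f x t) ∂ν := by
    have h : ∫⁻ t, f x t ∂ν ≤ 1 + ∫⁻ t, aboveOne (f x t) ∂ν := by
      refine (lintegral_mono fun t => le_one_add_aboveOne (f x t)).trans_eq ?_
      rw [lintegral_add_left measurable_const, lintegral_one, measure_univ]
    rw [← one_add_one_eq_two] at hx
    exact (lt_of_add_lt_add_left (hx.trans_le h)).le
  calc μ {x | 2 < ∫⁻ t, f x t ∂ν} ≤ μ {x | 1 ≤ ∫⁻ t, aboveOne (f x t) ∂ν} := measure_mono hsub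
    _ ≤ ∫⁻ x, ∫⁻ t, aboveOne (f x t) ∂ν ∂μ := by
        simpa using mul_meas_ge_le_lintegral₀ (μ := μ) hm.lintegral_prod_right' 1
    _ = ∫⁻ t, ∫⁻ x, aboveOne (f x t) ∂μ ∂ν := lintegral_lintegral_swap hm

theorem exists_inv_gauge_le (hK : Bornology.IsBounded K) (h0 : K ∈ 𝓝 0) :
    ∃ R, 0 < R ∧ ∀ w, (gauge K w)⁻¹ ≤ R * ‖w‖⁻¹ := by
  obtain ⟨R, hR⟩ := hK.subset_closedBall 0
  refine ⟨max R 1, by positivity, fun w => ?_⟩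
  rcases eq_or_ne w 0 with rfl | hw
  · simp
  have : 0 < ‖w‖ := norm_pos_iff.2 hw
  have h := le_gauge_of_subset_closedBall (absorbent_nhds_zero h0) (le_max_of_le_right zero_le_one)
    (hR.trans (Metric.closedBall_subset_closedBall (le_max_left R 1))) (x := w)
  simpa [div_eq_mul_inv] using inv_anti₀ (by positivity) h

theorem gaugeKernel_smul {r : ℝ} (hr : 0 < r) (z : E) :
    gaugeKernel p K (r • z)
      = ENNReal.ofReal (r⁻¹ ^ ((finrank ℝ E : ℝ) + p)) * gaugeKernel p K z := by
  rw [gaugeKernel, gaugeKernel, gauge_smul_of_nonneg hr.le, smul_eq_mul, mul_inv,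
    Real.mul_rpow (by positivity) (inv_nonneg.2 (gauge_nonneg z)),
    ENNReal.ofReal_mul (by positivity)]

theorem setOfPred_lt_inv_gauge_inter_superlevel (hK : Convex ℝ K) (h0 : K ∈ 𝓝 0)
    (hb : Bornology.IsBounded K) {φ : E → ℝ} (hom : ∀ (r : ℝ) x, 0 < r → φ (r • x) = r * φ x)
    {t : ℝ} (ht : 0 < t) :
    {w | t < (gauge K w)⁻¹} ∩ {w | 1 < φ w} = (t • ·) ⁻¹' ({y | t < φ y} ∩ interior K) := by
  have gauge_pos_of_one_lt (w : E) (hw : 1 < φ w) : 0 < gauge K w := by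
    refine (gauge_pos (absorbent_nhds_zero h0) ((NormedSpace.isVonNBounded_iff ℝ).2 hb)).2 ?_
    rintro rfl
    have := hom 2 0 two_pos
    rw [smul_zero] at this
    linarith
  ext w
  simp only [Set.mem_inter_iff, Set.mem_ofPred_eq, Set.mem_preimage, hom t w ht,
    ← setOfPred_gauge_lt_one_eq_interior hK h0, gauge_smul_of_nonneg ht.le, smul_eq_mul,
    lt_mul_iff_one_lt_right ht]
  rw [and_comm]
  refine and_congr_right fun hw => ?_
  rw [lt_inv_comm₀ ht (gauge_pos_of_one_lt w hw), ← one_div, lt_div_iff₀' ht]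

variable [MeasurableSpace E] [BorelSpace E]

theorem measurable_gaugeKernel (hK : Convex ℝ K) (h0 : K ∈ 𝓝 0) : Measurable (gaugeKernel p K) := by
  have := (continuous_gauge hK h0).measurable
  unfold gaugeKernel
  fun_prop

variable [FiniteDimensional ℝ E] {μ : Measure E} [μ.IsAddHaarMeasure]

theorem lintegral_comp_smul (f : E → ℝ≥0∞) {r : ℝ} (hr : 0 < r) :
    ∫⁻ w, f (r • w) ∂μ = ENNReal.ofReal (r⁻¹ ^ finrank ℝ E) * ∫⁻ z, f z ∂μ := by
  calc ∫⁻ w, f (r • w) ∂μ = ∫⁻ z, f z ∂μ.map (r • ·) :=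
        ((Homeomorph.smulOfNeZero r hr.ne').measurableEmbedding.lintegral_map f).symm
    _ = ENNReal.ofReal (r⁻¹ ^ finrank ℝ E) * ∫⁻ z, f z ∂μ := by
        rw [Measure.map_addHaar_smul μ hr.ne', lintegral_smul_measure, smul_eq_mul,
          abs_of_pos (by positivity), inv_pow]

theorem lintegral_gaugeKernel_mul_comp_smul (f : E → ℝ≥0∞) {r : ℝ} (hr : 0 < r) :
    ∫⁻ w, gaugeKernel p K w * f (r • w) ∂μ
      = ENNReal.ofReal (r ^ p) * ∫⁻ w, gaugeKernel p K w * f w ∂μ := by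
  have hk (w : E) : gaugeKernel p K w * f (r • w) = ENNReal.ofReal (r ^ ((finrank ℝ E : ℝ) + p)) *
      (gaugeKernel p K (r • w) * f (r • w)) := by
    rw [gaugeKernel_smul hr, mul_assoc, ← mul_assoc, ← ENNReal.ofReal_mul (by positivity),
      ← Real.mul_rpow (by positivity) (by positivity), mul_inv_cancel₀ hr.ne', Real.one_rpow,
      ENNReal.ofReal_one, one_mul]
  simp_rw [hk]
  rw [lintegral_const_mul' _ _ ENNReal.ofReal_ne_top,
    lintegral_comp_smul (fun z => gaugeKernel p K z * f z) hr, ← mul_assoc,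
    ← ENNReal.ofReal_mul (by positivity)]
  congr 2
  rw [Real.rpow_add hr, Real.rpow_natCast, inv_pow]
  field_simp

section Homogeneous

variable {φ : E → ℝ}

-- All level sets of positive level have the same measure up to a positive factor, and only
-- countably many of them can have positive measure.
theorem measure_levelSet_eq_zero_of_homogeneous (hφ : Measurable φ)
    (hom : ∀ (r : ℝ) x, 0 < r → φ (r • x) = r * φ x) {a : ℝ} (ha : 0 < a) :
    μ {x | φ x = a} = 0 := by
  by_contra hne
  have hpos (r : ℝ) (hr : 0 < r) : 0 < μ {x | φ x = r} := by
    have : 0 < r / a := by positivity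
    have hpre : (fun x => (a / r) • x) ⁻¹' {x | φ x = a} = {x | φ x = r} := by
      ext x
      simp only [Set.mem_preimage, Set.mem_ofPred_eq, hom (a / r) x (by positivity)]
      field_simp
    rw [← hpre, Measure.addHaar_preimage_smul μ (by positivity)]
    exact ENNReal.mul_pos (by simpa using (by positivity)) hne
  have hcount : (Set.Ioi (0 : ℝ)).Countable :=
    (Measure.countable_meas_level_set_pos hφ).mono hpos
  simpa using hcount.measure_zero volume

theorem measure_restrict_lt_inv_gauge_mul (hK : Convex ℝ K) (h0 : K ∈ 𝓝 0)
    (hb : Bornology.IsBounded K) (hφ : Measurable φ)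
    (hom : ∀ (r : ℝ) x, 0 < r → φ (r • x) = r * φ x) {t : ℝ} (ht : 0 < t) :
    μ.restrict {w | 1 < φ w} {w | t < (gauge K w)⁻¹}
        * ENNReal.ofReal (t ^ ((finrank ℝ E : ℝ) + p - 1))
      = μ.restrict (interior K) {y | t < φ y} * ENNReal.ofReal (t ^ (p - 1)) := by
  have hg : Measurable (gauge K) := (continuous_gauge hK h0).measurable
  rw [Measure.restrict_apply (measurableSet_lt measurable_const (by fun_prop)),
    Measure.restrict_apply (measurableSet_lt measurable_const hφ),
    setOfPred_lt_inv_gauge_inter_superlevel hK h0 hb hom ht, Measure.addHaar_preimage_smul μ ht.ne',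
    abs_of_pos (by positivity), mul_right_comm, mul_comm, ← ENNReal.ofReal_mul (by positivity)]
  congr 2
  rw [add_sub_assoc, Real.rpow_add ht, Real.rpow_natCast]
  field_simp

theorem setLIntegral_gaugeKernel_superlevel (hK : Convex ℝ K) (h0 : K ∈ 𝓝 0)
    (hb : Bornology.IsBounded K) (hp : 0 < p) (hφ : Measurable φ) (hφ0 : 0 ≤ φ)
    (hom : ∀ (r : ℝ) x, 0 < r → φ (r • x) = r * φ x) :
    ∫⁻ w in {w | 1 < φ w}, gaugeKernel p K w ∂μ
      = ENNReal.ofReal ((finrank ℝ E + p) / p)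
        * ∫⁻ y in interior K, ENNReal.ofReal (φ y ^ p) ∂μ := by
  set q : ℝ := finrank ℝ E + p
  have hq0 : 0 < q := by positivity
  calc ∫⁻ w in {w | 1 < φ w}, gaugeKernel p K w ∂μ
      = ENNReal.ofReal q * ∫⁻ t in Set.Ioi 0,
          μ.restrict {w | 1 < φ w} {w | t < (gauge K w)⁻¹} * ENNReal.ofReal (t ^ (q - 1)) :=
        lintegral_rpow_eq_lintegral_meas_lt_mul _
          (ae_of_all _ fun w => inv_nonneg.2 (gauge_nonneg w))
          (continuous_gauge hK h0).measurable.inv.aemeasurable hq0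
    _ = ENNReal.ofReal (q / p) * (ENNReal.ofReal p * ∫⁻ t in Set.Ioi 0,
          μ.restrict (interior K) {y | t < φ y} * ENNReal.ofReal (t ^ (p - 1))) := by
        rw [setLIntegral_congr_fun measurableSet_Ioi fun t ht =>
            measure_restrict_lt_inv_gauge_mul hK h0 hb hφ hom ht, ← mul_assoc,
          ← ENNReal.ofReal_mul (by positivity), div_mul_cancel₀ _ hp.ne']
    _ = ENNReal.ofReal (q / p) * ∫⁻ y in interior K, ENNReal.ofReal (φ y ^ p) ∂μ := by
        rw [lintegral_rpow_eq_lintegral_meas_lt_mul _ (ae_of_all _ hφ0) hφ.aemeasurable hp]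

end Homogeneous

theorem lintegral_gaugeKernel_mul_aboveOne_enorm_lt_top (hK : Bornology.IsBounded K)
    (h0 : K ∈ 𝓝 0) (hp : 1 < p) :
    ∫⁻ w, gaugeKernel p K w * aboveOne ‖w‖ₑ ∂μ < ⊤ := by
  obtain ⟨R, hR, hgauge⟩ := exists_inv_gauge_le hK h0
  set q : ℝ := finrank ℝ E + p with hq
  have hint := (integrable_one_add_norm (E := E) (μ := μ) (r := q - 1)
    (by rw [hq]; linarith)).const_mul (R ^ q * 2 ^ (q - 1))
  refine lt_of_le_of_lt (lintegral_mono fun w => ?_) hint.lintegral_lt_top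
  by_cases hw : ‖w‖ₑ ∈ Set.Ioi 1
  swap
  · simp [aboveOne, hw]
  have hw1 : 1 < ‖w‖ := by simpa [← ofReal_norm] using hw
  have hw0 : 0 < ‖w‖ := one_pos.trans hw1
  rw [aboveOne, Set.indicator_of_mem hw, id, gaugeKernel, ← ofReal_norm w,
    ← ENNReal.ofReal_mul (Real.rpow_nonneg (inv_nonneg.2 (gauge_nonneg w)) _)]
  refine ENNReal.ofReal_le_ofReal ?_
  calc (gauge K w)⁻¹ ^ q * ‖w‖ ≤ (R * ‖w‖⁻¹) ^ q * ‖w‖ := by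
        gcongr
        exacts [inv_nonneg.2 (gauge_nonneg w), hgauge w]
    _ = R ^ q * ‖w‖ ^ (-(q - 1)) := by
        rw [Real.mul_rpow hR.le (by positivity), Real.inv_rpow hw0.le, ← Real.rpow_neg hw0.le,
          mul_assoc, ← Real.rpow_add_one hw0.ne']
        congr 2
        ring
    _ ≤ R ^ q * ((1 + ‖w‖) / 2) ^ (-(q - 1)) := by
        gcongr ?_ * ?_
        exact Real.rpow_le_rpow_of_nonpos (by positivity) (by linarith) (by linarith)
    _ = R ^ q * 2 ^ (q - 1) * (1 + ‖w‖) ^ (-(q - 1)) := by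
        rw [Real.div_rpow (by positivity) (by positivity), Real.rpow_neg two_pos.le, div_inv_eq_mul]
        ring

theorem lintegral_gaugeKernel_mul_aboveOne_enorm_mul (hp : 0 < p) {a : ℝ≥0∞} (ha : a ≠ ⊤) :
    ∫⁻ w, gaugeKernel p K w * aboveOne (‖w‖ₑ * a) ∂μ
      = a ^ p * ∫⁻ w, gaugeKernel p K w * aboveOne ‖w‖ₑ ∂μ := by
  rcases eq_or_ne a 0 with rfl | ha0
  · simp [ENNReal.zero_rpow_of_pos hp, aboveOne]
  have hr : 0 < a.toReal := ENNReal.toReal_pos ha0 ha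
  have h := lintegral_gaugeKernel_mul_comp_smul (μ := μ) (p := p) (K := K) (aboveOne ‖·‖ₑ) hr
  have henorm (w : E) : ‖a.toReal • w‖ₑ = ‖w‖ₑ * a := by
    rw [enorm_smul, Real.enorm_of_nonneg hr.le, ENNReal.ofReal_toReal ha, mul_comm]
  simp_rw [henorm, ← ENNReal.ofReal_rpow_of_pos hr, ENNReal.ofReal_toReal ha] at h
  exact h

theorem lintegral_gaugeKernel_mul_lintegral_aboveOne_lt_top (hK : Convex ℝ K)
    (hb : Bornology.IsBounded K) (h0 : K ∈ 𝓝 0) (hp : 1 < p) {X : Type*} [MeasurableSpace X]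
    {ν : Measure X} [SFinite ν] {F : X → ℝ≥0∞} (hF : AEMeasurable F ν)
    (hFp : ∫⁻ x, F x ^ p ∂ν ≠ ⊤) :
    ∫⁻ w, gaugeKernel p K w * ∫⁻ x, aboveOne (‖w‖ₑ * F x) ∂ν ∂μ < ⊤ := by
  have hp0 : 0 < p := one_pos.trans hp
  have hk := measurable_gaugeKernel (p := p) hK h0
  have hm : AEMeasurable (Function.uncurry fun (w : E) (x : X) =>
      gaugeKernel p K w * aboveOne (‖w‖ₑ * F x)) (μ.prod ν) :=
    (hk.comp measurable_fst).aemeasurable.mul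
      (measurable_aboveOne.comp_aemeasurable (measurable_fst.enorm.aemeasurable.mul hF.comp_snd))
  have hfin : ∀ᵐ x ∂ν, F x ≠ ⊤ := by
    filter_upwards [ae_lt_top' (by fun_prop) hFp] with x hx h
    simp [h, hp0] at hx
  calc ∫⁻ w, gaugeKernel p K w * ∫⁻ x, aboveOne (‖w‖ₑ * F x) ∂ν ∂μ
      = ∫⁻ w, ∫⁻ x, gaugeKernel p K w * aboveOne (‖w‖ₑ * F x) ∂ν ∂μ :=
        lintegral_congr fun w => (lintegral_const_mul' _ _ ENNReal.ofReal_ne_top).symm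
    _ = ∫⁻ x, ∫⁻ w, gaugeKernel p K w * aboveOne (‖w‖ₑ * F x) ∂μ ∂ν :=
        lintegral_lintegral_swap hm
    _ = ∫⁻ x, F x ^ p * ∫⁻ w, gaugeKernel p K w * aboveOne ‖w‖ₑ ∂μ ∂ν := by
        refine lintegral_congr_ae ?_
        filter_upwards [hfin] with x hx
        exact lintegral_gaugeKernel_mul_aboveOne_enorm_mul hp0 hx
    _ < ⊤ := by
        rw [lintegral_mul_const'' _ (by fun_prop)]
        exact ENNReal.mul_lt_top hFp.lt_top
          (lintegral_gaugeKernel_mul_aboveOne_enorm_lt_top hb h0 hp)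

end GaugeKernel

section Translations

variable {E β : Type*} [NormedAddCommGroup E] [MeasurableSpace E] [BorelSpace E]
  [SecondCountableTopology E] {μ : Measure E} [SFinite μ] [μ.IsAddRightInvariant]
  [MeasurableSpace β] {ν : Measure β} [SFinite ν] {s : β → E}

theorem measurePreserving_add_comp_snd (hs : Measurable s) :
    MeasurePreserving (fun q : E × β => (q.1 + s q.2, q.2)) (μ.prod ν) (μ.prod ν) :=
  (Measure.measurePreserving_swap.comp ((MeasurePreserving.id ν).skew_product
    (g := fun t x => x + s t) (measurable_snd.add (hs.comp measurable_fst))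
    (ae_of_all _ fun t => map_add_right_eq_self μ (s t)))).comp Measure.measurePreserving_swap

theorem quasiMeasurePreserving_add_comp_snd (hs : Measurable s) :
    Measure.QuasiMeasurePreserving (fun q : E × β => q.1 + s q.2) (μ.prod ν) μ :=
  Measure.quasiMeasurePreserving_fst.comp
    (measurePreserving_add_comp_snd hs).quasiMeasurePreserving

end Translations

theorem ae_ae_eq_of_ae_ae_eq {α β F : Type*} [MeasurableSpace α] [MeasurableSpace β]
    [NormedAddCommGroup F] {μ : Measure α} [SFinite μ] {ν : Measure β} [SFinite ν] {f g : α → β → F}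
    (hf : AEStronglyMeasurable (Function.uncurry f) (μ.prod ν))
    (hg : AEStronglyMeasurable (Function.uncurry g) (μ.prod ν))
    (h : ∀ᵐ y ∂ν, ∀ᵐ x ∂μ, f x y = g x y) : ∀ᵐ x ∂μ, ∀ᵐ y ∂ν, f x y = g x y := by
  have hm := (hf.sub hg).enorm
  have h0 : ∫⁻ q, ‖(Function.uncurry f - Function.uncurry g) q‖ₑ ∂μ.prod ν = 0 := by
    rw [lintegral_prod_symm _ hm, lintegral_eq_zero_of_ae_eq_zero]
    filter_upwards [h] with y hy
    refine lintegral_eq_zero_of_ae_eq_zero ?_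
    filter_upwards [hy] with x hx
    simp [hx]
  filter_upwards [Measure.ae_ae_of_ae_prod ((lintegral_eq_zero_iff' hm).1 h0)] with x hx
  filter_upwards [hx] with y hy
  exact sub_eq_zero.1 (enorm_eq_zero.1 hy)

section WeakLineDeriv

variable {E F : Type*} [NormedAddCommGroup E] [NormedSpace ℝ E] [FiniteDimensional ℝ E]
  [MeasurableSpace E] [BorelSpace E] [NormedAddCommGroup F] {μ : Measure E}
  [μ.IsAddHaarMeasure] {u g : E → F} {z : E}

theorem integrable_comp_add_smul_prod (hg : LocallyIntegrable g μ) (z : E) {k : Set E}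
    (hk : IsCompact k) {T : Set ℝ} (hT : IsCompact T) :
    Integrable (fun q : E × ℝ => g (q.1 + q.2 • z))
      ((μ.restrict k).prod (volume.restrict T)) := by
  set k' : Set E := (fun q : E × ℝ => q.1 + q.2 • z) '' k ×ˢ T
  have hk'c : IsCompact k' := (hk.prod hT).image (by fun_prop)
  have := isFiniteMeasure_restrict.2 (hT.measure_lt_top (μ := volume)).ne
  have h : Integrable (fun q : E × ℝ => k'.indicator g q.1) (μ.prod (volume.restrict T)) :=
    ((hg.integrableOn_isCompact hk'c).integrable_indicator hk'c.measurableSet).comp_fst _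
  have h' := ((measurePreserving_add_comp_snd (μ := μ) (ν := volume.restrict T)
    (measurable_id.smul_const z)).integrable_comp_of_integrable h).mono_measure
      (Measure.prod_mono Measure.restrict_le_self le_rfl : (μ.restrict k).prod _ ≤ _)
  refine h'.congr ?_
  rw [Measure.prod_restrict]
  filter_upwards [ae_restrict_mem (hk.prod hT).measurableSet] with q hq
  exact Set.indicator_of_mem (Set.mem_image_of_mem _ hq) g

theorem ae_integrableOn_comp_add_smul (hg : LocallyIntegrable g μ) (z : E) {T : Set ℝ}
    (hT : IsCompact T) : ∀ᵐ x ∂μ, IntegrableOn (fun t => g (x + t • z)) T := by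
  rw [← Measure.restrict_univ (μ := μ), ← iUnion_compactCovering, ae_restrict_iUnion_iff]
  exact fun n =>
    (integrable_comp_add_smul_prod hg z (isCompact_compactCovering E n) hT).prod_right_ae

variable [NormedSpace ℝ F]

theorem locallyIntegrable_integral_comp_add_smul (hg : LocallyIntegrable g μ) (z : E) (a b : ℝ) :
    LocallyIntegrable (fun x => ∫ t in a..b, g (x + t • z)) μ := by
  refine locallyIntegrable_iff.2 fun k hk => ?_
  have h (a b : ℝ) : IntegrableOn (fun x => ∫ t in Set.Ioc a b, g (x + t • z)) k μ :=
    ((integrable_comp_add_smul_prod hg z hk (isCompact_Icc (a := a) (b := b))).mono_measure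
      (Measure.prod_mono le_rfl (Measure.restrict_mono_set _ Set.Ioc_subset_Icc_self))
      ).integral_prod_left
  exact (h a b).sub (h b a)

theorem integrable_smul_comp_add_smul_prod (hg : LocallyIntegrable g μ) (z : E) {φ : E → ℝ}
    (hφ : Continuous φ) (hc : HasCompactSupport φ) {T : Set ℝ} (hT : IsCompact T) :
    Integrable (fun q : E × ℝ => φ q.1 • g (q.1 + q.2 • z)) (μ.prod (volume.restrict T)) := by
  obtain ⟨C, hC⟩ := hφ.bounded_above_of_compact_support hc
  have h := (integrable_comp_add_smul_prod hg z hc hT).bdd_smul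
    (φ := fun q : E × ℝ => φ q.1) C
    (by fun_prop) (ae_of_all _ fun q => hC q.1)
  rw [← Measure.restrict_univ (μ := volume.restrict T), Measure.prod_restrict] at h
  refine (integrableOn_iff_integrable_of_support_subset fun q hq => ?_).1 h
  exact ⟨subset_tsupport φ (left_ne_zero_of_smul hq), trivial⟩

/-- `g` is the derivative of `u` in the direction `z` in the sense of distributions on `(E, μ)`,
tested against real-valued functions. -/
structure HasWeakLineDeriv (u g : E → F) (z : E) (μ : Measure E) : Prop where
  locallyIntegrable : LocallyIntegrable u μ
  locallyIntegrable_deriv : LocallyIntegrable g μ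
  integral_eq : ∀ φ : E → ℝ, ContDiff ℝ ((⊤ : ℕ∞) : WithTop ℕ∞) φ → HasCompactSupport φ →
    ∫ x, fderiv ℝ φ x z • u x ∂μ = -∫ x, φ x • g x ∂μ

namespace HasWeakLineDeriv

theorem hasDerivAt_integral_comp_sub_smul (h : HasWeakLineDeriv u g z μ) {φ : E → ℝ}
    (hφ : ContDiff ℝ ((⊤ : ℕ∞) : WithTop ℕ∞) φ) (hc : HasCompactSupport φ) (t : ℝ) :
    HasDerivAt (fun t : ℝ => ∫ x, φ (x - t • z) • u x ∂μ) (∫ x, φ (x - t • z) • g x ∂μ) t := by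
  let L : F →L[ℝ] ℝ →L[ℝ] F := (ContinuousLinearMap.lsmul ℝ ℝ).flip
  set ψ : E → ℝ := fun y => φ (-y) with hψ
  have hψs : ContDiff ℝ ((⊤ : ℕ∞) : WithTop ℕ∞) ψ := hφ.comp contDiff_neg
  have hψc : HasCompactSupport ψ := hc.comp_homeomorph (Homeomorph.neg E)
  have hconv := (hψc.hasFDerivAt_convolution_right L h.locallyIntegrable
    (hψs.of_le (by norm_cast)) (t • z)).comp_hasDerivAt t ((hasDerivAt_id t).smul_const z)
  have hshift : ContDiff ℝ ((⊤ : ℕ∞) : WithTop ℕ∞) fun x => φ (x - t • z) :=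
    hφ.comp (contDiff_id.sub contDiff_const)
  have htest := h.integral_eq _ hshift (hc.comp_homeomorph (Homeomorph.subRight (t • z)))
  have hval : (fun t : ℝ => ∫ x, φ (x - t • z) • u x ∂μ)
      = convolution u ψ L μ ∘ fun t : ℝ => t • z := by
    ext t
    simp [convolution, L, hψ]
  rw [hval]
  refine hconv.congr_deriv ?_
  rw [one_smul, convolution_precompR_apply L h.locallyIntegrable (hψc.fderiv (𝕜 := ℝ))
    (hψs.continuous_fderiv (by simp)), convolution_def, ← neg_eq_iff_eq_neg.2 htest, ← integral_neg]
  refine integral_congr_ae (ae_of_all _ fun x => ?_)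
  have hneg := ((hφ.differentiable (by simp) (-(t • z - x))).hasFDerivAt.comp (t • z - x)
    (hasFDerivAt_id _).neg).fderiv
  have hψ' : fderiv ℝ ψ (t • z - x) z = -fderiv ℝ φ (x - t • z) z := by
    rw [← neg_sub (t • z) x]
    exact (congrArg (fun D : E →L[ℝ] ℝ => D z) hneg).trans (by simp)
  simp only [L, ContinuousLinearMap.flip_apply, ContinuousLinearMap.lsmul_apply, hψ',
    fderiv_comp_sub, neg_smul]

variable [CompleteSpace F]

theorem ae_sub_eq_integral (h : HasWeakLineDeriv u g z μ) (t : ℝ) :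
    ∀ᵐ x ∂μ, u (x + t • z) - u x = ∫ s in (0 : ℝ)..t, g (x + s • z) := by
  have hut : LocallyIntegrable (fun x => u (x + t • z)) μ :=
    (locallyIntegrable_map_homeomorph (Homeomorph.addRight (t • z))).1
      ((map_add_right_eq_self μ (t • z)).symm ▸ h.locallyIntegrable)
  refine ae_eq_of_integral_contDiff_smul_eq (hut.sub h.locallyIntegrable)
    (locallyIntegrable_integral_comp_add_smul h.locallyIntegrable_deriv z 0 t) fun φ hφ hc => ?_
  have translate (v : E → F) (s : ℝ) :
      ∫ x, φ (x - s • z) • v x ∂μ = ∫ x, φ x • v (x + s • z) ∂μ := by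
    rw [← integral_add_right_eq_self _ (s • z)]
    simp only [add_sub_cancel_right]
  have hint := (integrable_smul_comp_add_smul_prod h.locallyIntegrable_deriv z hφ.continuous hc
    (isCompact_uIcc (a := 0) (b := t))).mono_measure
    (Measure.prod_mono le_rfl (Measure.restrict_mono_set volume Set.uIoc_subset_uIcc))
  calc ∫ x, φ x • (u (x + t • z) - u x) ∂μ
      = ∫ x, φ (x - t • z) • u x ∂μ - ∫ x, φ (x - (0 : ℝ) • z) • u x ∂μ := by
        rw [translate, translate, ← integral_sub]
        · simp [smul_sub]
        · exact hut.integrable_smul_left_of_hasCompactSupport hφ.continuous hc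
        · simpa using h.locallyIntegrable.integrable_smul_left_of_hasCompactSupport hφ.continuous hc
    _ = ∫ s in (0 : ℝ)..t, ∫ x, φ (x - s • z) • g x ∂μ := by
        refine (intervalIntegral.integral_eq_sub_of_hasDerivAt
          (fun s _ => h.hasDerivAt_integral_comp_sub_smul hφ hc s) ?_).symm
        simp_rw [translate, intervalIntegrable_iff]
        exact hint.integral_prod_right
    _ = ∫ s in (0 : ℝ)..t, ∫ x, φ x • g (x + s • z) ∂μ := by simp_rw [translate]
    _ = ∫ x, (∫ s in (0 : ℝ)..t, φ x • g (x + s • z)) ∂μ :=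
        intervalIntegral_integral_swap hint.swap
    _ = ∫ x, φ x • (∫ s in (0 : ℝ)..t, g (x + s • z)) ∂μ := by
        simp_rw [intervalIntegral.integral_smul]

theorem ae_ae_sub_eq_integral (h : HasWeakLineDeriv u g z μ) :
    ∀ᵐ x ∂μ, ∀ᵐ t ∂volume.restrict (Set.Ioc 0 1),
      u (x + t • z) - u x = ∫ s in (0 : ℝ)..t, g (x + s • z) := by
  set ν : Measure ℝ := volume.restrict (Set.Ioc 0 1)
  have hline := quasiMeasurePreserving_add_comp_snd (μ := μ) (ν := ν) (measurable_id.smul_const z)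
  have hu := h.locallyIntegrable.aestronglyMeasurable
  have hg := h.locallyIntegrable_deriv.aestronglyMeasurable.comp_quasiMeasurePreserving hline
  have hprim : AEStronglyMeasurable
      (fun q : E × ℝ => ∫ s, (Set.Iic q.2).indicator (fun s => g (q.1 + s • z)) s ∂ν)
      (μ.prod ν) := by
    have hm : MeasurableSet {q : (E × ℝ) × ℝ | q.2 ≤ q.1.2} :=
      measurableSet_le (by fun_prop) (by fun_prop)
    have hfst : Measure.QuasiMeasurePreserving (fun q : (E × ℝ) × ℝ => (q.1.1, q.2))
        ((μ.prod ν).prod ν) (μ.prod ν) :=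
      QuasiMeasurePreserving.prodMap Measure.quasiMeasurePreserving_fst (.id ν)
    exact ((hg.comp_quasiMeasurePreserving hfst).indicator hm).integral_prod_right'
  refine ae_ae_eq_of_ae_ae_eq ((hu.comp_quasiMeasurePreserving hline).sub hu.comp_fst)
    (hprim.congr ?_) (ae_of_all _ h.ae_sub_eq_integral)
  filter_upwards [Measure.quasiMeasurePreserving_snd.ae (ae_restrict_mem measurableSet_Ioc)]
    with q hq
  rw [integral_indicator measurableSet_Iic, Measure.restrict_restrict measurableSet_Iic,
    Set.inter_comm, Set.Ioc_inter_Iic, min_eq_right hq.2, Function.uncurry,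
    intervalIntegral.integral_of_le hq.1.le]

omit [μ.IsAddHaarMeasure] in
theorem ae_eq {g' : E → F} (h : HasWeakLineDeriv u g z μ) (h' : HasWeakLineDeriv u g' z μ) :
    g =ᵐ[μ] g' :=
  ae_eq_of_integral_contDiff_smul_eq h.locallyIntegrable_deriv h'.locallyIntegrable_deriv
    fun φ hφ hc => neg_injective ((h.integral_eq φ hφ hc).symm.trans (h'.integral_eq φ hφ hc))

end HasWeakLineDeriv
end WeakLineDeriv

section Phase

variable {𝕜 : Type*} [RCLike 𝕜] {e e' f g : ℝ → 𝕜} {a b : ℝ}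

theorem integral_mul_primitive_eq (he : ∀ t, HasDerivAt e (e' t) t) (he' : Continuous e')
    (hab : a ≤ b) (hg : IntegrableOn g (Set.Ioc a b)) :
    ∫ t in a..b, e' t * ∫ s in a..t, g s = ∫ s in a..b, (e b - e s) * g s := by
  set ν : Measure ℝ := volume.restrict (Set.Ioc a b)
  have hint : Integrable (fun q : ℝ × ℝ => {q : ℝ × ℝ | q.2 ≤ q.1}.indicator
      (fun q => e' q.1 * g q.2) q) (ν.prod ν) :=
    ((he'.integrableOn_Ioc (a := a) (b := b)).mul_prod hg).indicator
      (measurableSet_le measurable_snd measurable_fst)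
  rw [intervalIntegral.integral_of_le hab, intervalIntegral.integral_of_le hab]
  calc ∫ t in Set.Ioc a b, e' t * ∫ s in a..t, g s
      = ∫ t, ∫ s, {q : ℝ × ℝ | q.2 ≤ q.1}.indicator (fun q => e' q.1 * g q.2) (t, s) ∂ν ∂ν := by
        refine setIntegral_congr_fun measurableSet_Ioc fun t ht => ?_
        have hmem (s : ℝ) : {q : ℝ × ℝ | q.2 ≤ q.1}.indicator (fun q => e' q.1 * g q.2) (t, s)
            = (Set.Iic t).indicator (fun s => e' t * g s) s := rfl
        simp_rw [hmem, integral_indicator measurableSet_Iic]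
        rw [Measure.restrict_restrict measurableSet_Iic, Set.inter_comm, Set.Ioc_inter_Iic,
          min_eq_right ht.2, integral_const_mul_of_integrable
            (hg.mono_set (Set.Ioc_subset_Ioc_right ht.2)), intervalIntegral.integral_of_le ht.1.le]
    _ = ∫ s, ∫ t, {q : ℝ × ℝ | q.2 ≤ q.1}.indicator (fun q => e' q.1 * g q.2) (t, s) ∂ν ∂ν :=
        integral_integral_swap hint
    _ = ∫ s in Set.Ioc a b, (e b - e s) * g s := by
        refine setIntegral_congr_fun measurableSet_Ioc fun s hs => ?_
        have hmem (t : ℝ) : {q : ℝ × ℝ | q.2 ≤ q.1}.indicator (fun q => e' q.1 * g q.2) (t, s)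
            = (Set.Ici s).indicator (fun t => e' t * g s) t := rfl
        have hset : Set.Ici s ∩ Set.Ioc a b = Set.Icc s b := by
          ext t
          have := hs.1
          simp only [Set.mem_inter_iff, Set.mem_Ici, Set.mem_Ioc, Set.mem_Icc]
          grind
        simp_rw [hmem, integral_indicator measurableSet_Ici]
        rw [Measure.restrict_restrict measurableSet_Ici, hset, integral_mul_const_of_integrable
          (he'.integrableOn_Icc), integral_Icc_eq_integral_Ioc,
          ← intervalIntegral.integral_of_le hs.2, intervalIntegral.integral_eq_sub_of_hasDerivAt
            (fun t _ => he t) (he'.intervalIntegrable _ _)]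

theorem mul_sub_mul_eq_integral (he : ∀ t, HasDerivAt e (e' t) t) (he' : Continuous e')
    (hab : a ≤ b) (hg : IntegrableOn g (Set.Ioc a b))
    (hf : ∀ᵐ t ∂volume.restrict (Set.Ioc a b), f t - f a = ∫ s in a..t, g s)
    (hfb : f b - f a = ∫ s in a..b, g s) :
    e b * f b - e a * f a = ∫ t in a..b, e t * g t + e' t * f t := by
  have hec : Continuous e := continuous_iff_continuousAt.2 fun t => (he t).continuousAt
  have hgi : IntervalIntegrable g volume a b :=
    (intervalIntegrable_iff_integrableOn_Ioc_of_le hab).2 hg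
  have hprim : IntervalIntegrable (fun t => e' t * ∫ s in a..t, g s) volume a b := by
    refine (ContinuousOn.mul he'.continuousOn ?_).intervalIntegrable
    exact intervalIntegral.continuousOn_primitive_interval' hgi Set.left_mem_uIcc
  have hcongr : ∫ t in a..b, e t * g t + e' t * f t
      = ∫ t in a..b, (e t * g t + e' t * f a) + e' t * ∫ s in a..t, g s := by
    refine intervalIntegral.integral_congr_ae_restrict ?_
    rw [Set.uIoc_of_le hab]
    filter_upwards [hf] with t ht
    rw [← ht, mul_sub]
    abel
  have h1 := hgi.continuousOn_mul hec.continuousOn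
  have h2 : IntervalIntegrable (fun t => e' t * f a) volume a b :=
    (he'.mul continuous_const).intervalIntegrable _ _
  rw [hcongr, intervalIntegral.integral_add (h1.add h2) hprim, intervalIntegral.integral_add h1 h2,
    integral_mul_primitive_eq he he' hab hg]
  simp_rw [sub_mul]
  rw [intervalIntegral.integral_sub (hgi.const_mul (e b)) h1, intervalIntegral.integral_mul_const,
    intervalIntegral.integral_const_mul, ← hfb, intervalIntegral.integral_eq_sub_of_hasDerivAt
      (fun t _ => he t) (he'.intervalIntegrable _ _)]
  ring

open Complex in
theorem HasWeakLineDeriv.ae_exp_mul_sub_eq_integral {E : Type*} [NormedAddCommGroup E]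
    [NormedSpace ℝ E] [FiniteDimensional ℝ E] [MeasurableSpace E] [BorelSpace E] {μ : Measure E}
    [μ.IsAddHaarMeasure] {u g : E → ℂ} {z : E} (h : HasWeakLineDeriv u g z μ) :
    ∀ᵐ x ∂μ, ∀ s : ℝ, exp (-(I * s)) * u (x + z) - u x
      = ∫ t in (0 : ℝ)..1, exp (-(I * s * t)) * (g (x + t • z) - I * s * u (x + t • z)) := by
  filter_upwards [h.ae_ae_sub_eq_integral, h.ae_sub_eq_integral 1,
    ae_integrableOn_comp_add_smul h.locallyIntegrable_deriv z isCompact_Icc] with x hx hx1 hg s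
  have he (t : ℝ) :
      HasDerivAt (fun t : ℝ => exp (-(I * s * t))) (-(I * s) * exp (-(I * s * t))) t := by
    have := ((hasDerivAt_id t).ofReal_comp.const_mul (I * s)).neg.cexp
    simpa [mul_comm] using this
  have := mul_sub_mul_eq_integral (f := fun t : ℝ => u (x + t • z)) he (by fun_prop) zero_le_one
    (hg.mono_set Set.Ioc_subset_Icc_self) (by simpa using hx) (by simpa using hx1)
  simp only [ofReal_one, mul_one, one_smul, ofReal_zero, mul_zero, neg_zero, exp_zero, one_mul,
    zero_smul, add_zero] at this
  rw [this]
  refine intervalIntegral.integral_congr fun t _ => ?_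
  ring

end Phase

section AbsP

variable {p : ℝ}

theorem absP_nonneg (p : ℝ) (z : ℂ) : 0 ≤ absP p z := by unfold absP; positivity

theorem absP_pos {z : ℂ} (hz : z ≠ 0) : 0 < absP p z := by
  refine Real.rpow_pos_of_pos ?_ _
  by_cases hre : z.re = 0
  · have him : z.im ≠ 0 := fun him => hz (Complex.ext hre him)
    positivity
  · positivity

theorem continuous_absP (hp : 0 < p) : Continuous (absP p) :=
  .rpow_const (.add (.rpow_const (by fun_prop) fun _ => .inr hp.le)
    (.rpow_const (by fun_prop) fun _ => .inr hp.le)) fun _ => .inr (by positivity)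

theorem absP_ofReal_mul (hp : 0 < p) (r : ℝ) (z : ℂ) : absP p (r * z) = |r| * absP p z := by
  simp only [absP, Complex.re_ofReal_mul, Complex.im_ofReal_mul, abs_mul]
  rw [Real.mul_rpow (by positivity) (by positivity), Real.mul_rpow (by positivity) (by positivity),
    ← mul_add, Real.mul_rpow (by positivity) (by positivity), ← Real.rpow_mul (abs_nonneg r),
    mul_one_div_cancel hp.ne', Real.rpow_one]

theorem absP_add_le (hp : 1 ≤ p) (z w : ℂ) : absP p (z + w) ≤ absP p z + absP p w := by
  simpa [absP] using Real.Lp_add_le (Finset.univ : Finset (Fin 2)) ![z.re, z.im] ![w.re, w.im] hp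

theorem absP_le_two_mul_norm (hp : 1 ≤ p) (z : ℂ) : absP p z ≤ 2 * ‖z‖ := by
  have hp0 : 0 < p := by positivity
  have h1 : absP p 1 = 1 := by simp [absP, hp0.ne']
  have hI : absP p Complex.I = 1 := by simp [absP, hp0.ne']
  calc absP p z = absP p (z.re * 1 + z.im * Complex.I) := by rw [mul_one, Complex.re_add_im]
    _ ≤ |z.re| + |z.im| := by
        rw [← mul_one |z.re|, ← h1, ← absP_ofReal_mul hp0, ← mul_one |z.im|, ← hI,
          ← absP_ofReal_mul hp0]
        exact absP_add_le hp _ _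
    _ ≤ 2 * ‖z‖ := by linarith [z.abs_re_le_norm, z.abs_im_le_norm]

theorem abs_absP_sub_absP_le (hp : 1 ≤ p) (z w : ℂ) :
    |absP p z - absP p w| ≤ 2 * ‖z - w‖ := by
  have h1 := absP_add_le hp (z - w) w
  have h2 := absP_add_le hp (w - z) z
  rw [sub_add_cancel] at h1 h2
  have h3 := absP_le_two_mul_norm hp (w - z)
  rw [norm_sub_rev] at h3
  rw [abs_le]
  constructor <;> linarith [absP_le_two_mul_norm hp (z - w)]

end AbsP

section Cdot

variable {N : ℕ}

theorem continuous_cdot : Continuous fun q : CN N × RN N => cdot q.1 q.2 := by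
  unfold cdot; fun_prop

theorem cdot_smul (v : CN N) (r : ℝ) (x : RN N) : cdot v (r • x) = r * cdot v x := by
  simp only [cdot, PiLp.smul_apply, smul_eq_mul, Complex.ofReal_mul, Finset.mul_sum, mul_left_comm]

theorem smul_cdot (r : ℝ) (v : CN N) (x : RN N) : cdot (r • v) x = r * cdot v x := by
  simp only [cdot, PiLp.smul_apply, Complex.real_smul, Finset.mul_sum, mul_assoc]

theorem sub_cdot (v w : CN N) (x : RN N) : cdot (v - w) x = cdot v x - cdot w x := by
  simp [cdot, sub_mul, Finset.sum_sub_distrib]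

theorem cdot_single (v : CN N) (j : Fin N) : cdot v (EuclideanSpace.single j 1) = v j := by
  simp [cdot, PiLp.single_apply, apply_ite Complex.ofReal]

theorem norm_cdot_le (v : CN N) (x : RN N) : ‖cdot v x‖ ≤ ‖v‖ * ‖x‖ := by
  rw [EuclideanSpace.norm_eq, EuclideanSpace.norm_eq]
  calc ‖cdot v x‖ ≤ ∑ j, ‖v j‖ * ‖x j‖ :=
        (norm_sum_le _ _).trans_eq (by simp only [norm_mul, Complex.norm_real])
    _ ≤ _ := Real.sum_mul_le_sqrt_mul_sqrt _ _ _

end Cdot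

section MomentNorm

theorem exists_norm_le_mul_of_homogeneous {E : Type*} [NormedAddCommGroup E] [NormedSpace ℝ E]
    [FiniteDimensional ℝ E] {φ : E → ℝ} (hφ : Continuous φ) (hpos : ∀ x, x ≠ 0 → 0 < φ x)
    (hom : ∀ (r : ℝ) x, 0 ≤ r → φ (r • x) = r * φ x) : ∃ C, ∀ x, ‖x‖ ≤ C * φ x := by
  have hcont : ContinuousOn (fun x => (φ x)⁻¹) (Metric.sphere 0 1) :=
    hφ.continuousOn.inv₀ fun x hx => (hpos x (ne_zero_of_mem_unit_sphere ⟨x, hx⟩)).ne'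
  obtain ⟨C, hC⟩ := (isCompact_sphere (0 : E) 1).exists_bound_of_continuousOn hcont
  refine ⟨C, fun x => ?_⟩
  rcases eq_or_ne x 0 with rfl | hx
  · have h0 : φ 0 = 0 := by simpa only [zero_smul, zero_mul] using hom 0 0 le_rfl
    rw [norm_zero, h0, mul_zero]
  have : 0 < ‖x‖ := norm_pos_iff.2 hx
  have h := (Real.le_norm_self _).trans (hC (‖x‖⁻¹ • x) (by simp [norm_smul, hx]))
  rw [hom _ _ (by positivity), mul_inv, inv_inv, ← div_eq_mul_inv] at h
  exact (div_le_iff₀ (hpos x hx)).1 h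

variable {N : ℕ} {p : ℝ} {K : Set (RN N)}

namespace IsNormUnitBall

theorem mem_nhds (hK : IsNormUnitBall K) : K ∈ 𝓝 0 :=
  mem_interior_iff_mem_nhds.1 hK.zero_mem_interior

theorem gauge_neg (hK : IsNormUnitBall K) (x : RN N) : gauge K (-x) = gauge K x :=
  _root_.gauge_neg hK.symmetric x

end IsNormUnitBall

theorem continuous_absP_cdot (hp : 0 < p) :
    Continuous fun q : CN N × RN N => absP p (cdot q.1 q.2) :=
  (continuous_absP hp).comp continuous_cdot

theorem continuous_absP_cdot_rpow (hp : 0 < p) :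
    Continuous fun q : CN N × RN N => absP p (cdot q.1 q.2) ^ p :=
  (continuous_absP_cdot hp).rpow_const fun _ => .inr hp.le

theorem integral_absP_cdot_rpow_nonneg (p : ℝ) (K : Set (RN N)) (v : CN N) :
    0 ≤ ∫ x in K, absP p (cdot v x) ^ p :=
  integral_nonneg fun _ => Real.rpow_nonneg (absP_nonneg _ _) _

theorem momentNorm_nonneg (hp : 0 < p) (v : CN N) : 0 ≤ momentNorm p K v := by
  have := integral_absP_cdot_rpow_nonneg p K v
  unfold momentNorm
  positivity

theorem momentNorm_rpow (hp : 0 < p) (v : CN N) :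
    momentNorm p K v ^ p = (N + p) / p * ∫ x in K, absP p (cdot v x) ^ p := by
  have := integral_absP_cdot_rpow_nonneg p K v
  rw [momentNorm, ← Real.rpow_mul (by positivity), one_div_mul_cancel hp.ne', Real.rpow_one]

theorem momentNorm_smul (hp : 0 < p) {r : ℝ} (hr : 0 ≤ r) (v : CN N) :
    momentNorm p K (r • v) = r * momentNorm p K v := by
  have := integral_absP_cdot_rpow_nonneg p K v
  have h (x : RN N) : absP p (cdot (r • v) x) ^ p = r ^ p * absP p (cdot v x) ^ p := by
    rw [smul_cdot, absP_ofReal_mul hp, abs_of_nonneg hr, Real.mul_rpow hr (absP_nonneg _ _)]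
  simp_rw [momentNorm, h]
  rw [integral_const_mul, mul_left_comm, Real.mul_rpow (by positivity) (by positivity),
    ← Real.rpow_mul hr, mul_one_div_cancel hp.ne', Real.rpow_one]

namespace IsNormUnitBall

theorem integrableOn_absP_cdot_rpow (hK : IsNormUnitBall K) (hp : 0 < p) (v : CN N) :
    IntegrableOn (fun x => absP p (cdot v x) ^ p) K := by
  have hc := (continuous_absP_cdot_rpow hp).comp (Continuous.prodMk_right v)
  exact (hc.continuousOn.integrableOn_compact hK.bounded.isCompact_closure).mono_set subset_closure

theorem continuous_momentNorm (hK : IsNormUnitBall K) (hp : 0 < p) :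
    Continuous (momentNorm p K) := by
  have h := continuous_parametric_integral_of_continuous (μ := volume)
    (f := fun (v : CN N) (x : RN N) => absP p (cdot v x) ^ p) (continuous_absP_cdot_rpow hp)
    hK.bounded.isCompact_closure
  have hcl (v : CN N) : ∫ x in closure K, absP p (cdot v x) ^ p = ∫ x in K, absP p (cdot v x) ^ p :=
    setIntegral_congr_set (closure_ae_eq_of_null_frontier (hK.convex.addHaar_frontier volume))
  simp_rw [hcl] at h
  exact (continuous_const.mul h).rpow_const fun _ => .inr (by positivity)

theorem momentNorm_pos (hK : IsNormUnitBall K) (hp : 0 < p) {v : CN N} (hv : v ≠ 0) :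
    0 < momentNorm p K v := by
  have hc := (continuous_absP_cdot_rpow hp).comp (Continuous.prodMk_right v)
  obtain ⟨j, hj⟩ : ∃ j, v j ≠ 0 := by
    by_contra! h
    exact hv (PiLp.ext h)
  obtain ⟨r, hr, hrK⟩ : ∃ r : ℝ, 0 < r ∧ r • EuclideanSpace.single j 1 ∈ interior K := by
    have hlim : Tendsto (fun r : ℝ => r • (EuclideanSpace.single j 1 : RN N)) (𝓝[>] 0) (𝓝 0) :=
      tendsto_nhdsWithin_of_tendsto_nhds (Continuous.tendsto' (by fun_prop) _ _ (zero_smul _ _))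
    exact (eventually_mem_nhdsWithin.and
      (hlim.eventually_mem (isOpen_interior.mem_nhds hK.zero_mem_interior))).exists
  have hpos : 0 < ∫ x in K, absP p (cdot v x) ^ p := by
    rw [setIntegral_pos_iff_support_of_nonneg_ae
      (ae_of_all _ fun x => Real.rpow_nonneg (absP_nonneg _ _) _)
      (hK.integrableOn_absP_cdot_rpow hp v)]
    refine lt_of_lt_of_le (IsOpen.measure_pos volume (hc.isOpen_support.inter isOpen_interior)
      ⟨_, ?_, hrK⟩) (measure_mono (Set.inter_subset_inter_right _ interior_subset))
    refine (Real.rpow_pos_of_pos (absP_pos ?_) p).ne'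
    simp [cdot_smul, cdot_single, hr.ne', hj]
  unfold momentNorm
  positivity

theorem exists_norm_le_mul_momentNorm (hK : IsNormUnitBall K) (hp : 0 < p) :
    ∃ C, ∀ v, ‖v‖ ≤ C * momentNorm p K v :=
  exists_norm_le_mul_of_homogeneous (hK.continuous_momentNorm hp) (fun _ => hK.momentNorm_pos hp)
    fun _ v hr => momentNorm_smul hp hr v

theorem setLIntegral_gaugeKernel_absP_cdot (hK : IsNormUnitBall K) (hp : 0 < p) (v : CN N) :
    ∫⁻ w in {w | 1 < absP p (cdot v w)}, gaugeKernel p K w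
      = ENNReal.ofReal (momentNorm p K v ^ p) := by
  have hc : Continuous fun w => absP p (cdot v w) :=
    (continuous_absP hp).comp (continuous_cdot.comp (Continuous.prodMk_right v))
  rw [setLIntegral_gaugeKernel_superlevel hK.convex hK.mem_nhds hK.bounded hp hc.measurable
      (fun _ => absP_nonneg _ _) fun r x hr => by
        rw [cdot_smul, absP_ofReal_mul hp, abs_of_pos hr],
    setLIntegral_congr (interior_ae_eq_of_null_frontier (hK.convex.addHaar_frontier _)),
    momentNorm_rpow hp, ENNReal.ofReal_mul (by positivity), ofReal_integral_eq_lintegral_ofReal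
      (hK.integrableOn_absP_cdot_rpow hp v)
      (ae_of_all _ fun x => Real.rpow_nonneg (absP_nonneg _ _) _), finrank_euclideanSpace_fin]

end IsNormUnitBall

end MomentNorm

section WeakGradient

variable {N : ℕ} {u : RN N → ℂ} {G : RN N → CN N}

theorem locallyIntegrable_cdot (hG : LocallyIntegrable G) (z : RN N) :
    LocallyIntegrable fun x => cdot (G x) z := by
  have hz : Continuous fun v : CN N => cdot v z := continuous_cdot.comp (Continuous.prodMk_left z)
  refine (hG.smul ‖z‖).mono (hz.comp_aestronglyMeasurable hG.aestronglyMeasurable)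
    (ae_of_all _ fun x => ?_)
  rw [Pi.smul_apply, norm_smul, norm_norm, mul_comm]
  exact norm_cdot_le (G x) z

namespace IsWeakGradient

theorem hasWeakLineDeriv (h : IsWeakGradient u G) (z : RN N) :
    HasWeakLineDeriv u (fun x => cdot (G x) z) z volume := by
  refine ⟨h.locallyIntegrable, locallyIntegrable_cdot h.locallyIntegrable_grad z, fun φ hφ hc => ?_⟩
  have hz : z = ∑ j, z j • EuclideanSpace.single j (1 : ℝ) := by
    conv_lhs => rw [← (EuclideanSpace.basisFun (Fin N) ℝ).sum_repr z]
    simp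
  have hL (x : RN N) : fderiv ℝ φ x z • u x
      = ∑ j, z j • (fderiv ℝ φ x (EuclideanSpace.single j 1) • u x) := by
    conv_lhs => rw [hz]
    simp only [map_sum, map_smul, smul_eq_mul, Finset.sum_smul, mul_smul]
  have hR (x : RN N) : φ x • cdot (G x) z = ∑ j, z j • (φ x • G x j) := by
    simp only [cdot, Finset.smul_sum, Complex.real_smul]
    exact Finset.sum_congr rfl fun _ _ => by ring
  have hGj (j : Fin N) : LocallyIntegrable fun x => G x j := by
    simpa only [cdot_single] using
      locallyIntegrable_cdot h.locallyIntegrable_grad (EuclideanSpace.single j 1)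
  have hdφ (j : Fin N) : Integrable fun x => fderiv ℝ φ x (EuclideanSpace.single j 1) • u x :=
    h.locallyIntegrable.integrable_smul_left_of_hasCompactSupport
      ((hφ.continuous_fderiv (by simp)).clm_apply continuous_const)
      ((hc.fderiv (𝕜 := ℝ)).comp_left
        (g := fun D : RN N →L[ℝ] ℝ => D (EuclideanSpace.single j 1)) rfl)
  have hφG (j : Fin N) : Integrable fun x => φ x • G x j :=
    (hGj j).integrable_smul_left_of_hasCompactSupport hφ.continuous hc
  simp_rw [hL, hR]
  rw [integral_finsetSum _ fun j _ => (hdφ j).fun_smul (z j),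
    integral_finsetSum _ fun j _ => (hφG j).fun_smul (z j), ← Finset.sum_neg_distrib]
  refine Finset.sum_congr rfl fun j _ => ?_
  rw [integral_smul, integral_smul, ← smul_neg]
  exact congrArg (z j • ·) (h.integral_eq φ hφ hc j)

theorem ae_eq {G' : RN N → CN N} (h : IsWeakGradient u G) (h' : IsWeakGradient u G') :
    G =ᵐ[volume] G' := by
  have hj (j : Fin N) : ∀ᵐ x, G x j = G' x j := by
    filter_upwards [(h.hasWeakLineDeriv (EuclideanSpace.single j 1)).ae_eq
      (h'.hasWeakLineDeriv _)] with x hx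
    simpa only [cdot_single] using hx
  filter_upwards [ae_all_iff.2 hj] with x hx
  exact PiLp.ext hx

end IsWeakGradient
end WeakGradient

section MagneticIncrement

open Complex (I)

variable {N : ℕ} {A : RN N → RN N} {u : RN N → ℂ} {G : RN N → CN N}

/-- The increment `Ψ_u(x, x + z) - Ψ_u(x, x)`, as a function of the step `z` and the base point `x`:
the nonlocal functional measures its superlevel sets in `x` for fixed `z`. -/
def psiDiff (A : RN N → RN N) (u : RN N → ℂ) (z x : RN N) : ℂ :=
  Psi A u x (x + z) - Psi A u x x

/-- The phase `z · A(x + z / 2)` of `Ψ_u(x, x + z)`, up to sign. -/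
def midpointPhase (A : RN N → RN N) (z x : RN N) : ℝ :=
  inner ℝ z (A (x + (1 / 2 : ℝ) • z))

/-- The derivative in `t` of `e^{-i t φ} u(x + t z)`, where `φ` is the phase of `Ψ_u(x, x + z)` and
`G` plays the role of `∇u`. -/
def psiLineDeriv (A : RN N → RN N) (u : RN N → ℂ) (G : RN N → CN N) (z x : RN N) (t : ℝ) : ℂ :=
  Complex.exp (-(I * midpointPhase A z x * t)) *
    (cdot (G (x + t • z)) z - I * midpointPhase A z x * u (x + t • z))

theorem norm_exp_neg_I_mul (s t : ℝ) : ‖Complex.exp (-(I * s * t))‖ = 1 := by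
  simpa [mul_assoc] using Complex.norm_exp_I_mul_ofReal (-(s * t))

theorem norm_exp_neg_I_mul_sub_one_le (s : ℝ) {t : ℝ} (ht : t ∈ Set.Ioc (0 : ℝ) 1) :
    ‖Complex.exp (-(I * s * t)) - 1‖ ≤ min 2 |s| := by
  refine le_min ?_ ?_
  · calc ‖Complex.exp (-(I * s * t)) - 1‖ ≤ ‖Complex.exp (-(I * s * t))‖ + ‖(1 : ℂ)‖ :=
          norm_sub_le _ _
      _ = 2 := by rw [norm_exp_neg_I_mul, norm_one, one_add_one_eq_two]
  · calc ‖Complex.exp (-(I * s * t)) - 1‖ = ‖Complex.exp (I * (-(s * t) : ℝ)) - 1‖ := by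
          push_cast; ring_nf
      _ ≤ |s| * |t| := by
          simpa [abs_mul] using Real.norm_exp_I_mul_ofReal_sub_one_le (x := -(s * t))
      _ ≤ |s| := mul_le_of_le_one_right (abs_nonneg s) (by rw [abs_of_pos ht.1]; exact ht.2)

theorem Psi_self (A : RN N → RN N) (u : RN N → ℂ) (x : RN N) : Psi A u x x = u x := by
  simp [Psi]

theorem Psi_add (A : RN N → RN N) (u : RN N → ℂ) (x z : RN N) :
    Psi A u x (x + z) = Complex.exp (-(I * midpointPhase A z x)) * u (x + z) := by
  have hmid : (1 / 2 : ℝ) • (x + (x + z)) = x + (1 / 2 : ℝ) • z := by module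
  rw [Psi, sub_add_cancel_left, hmid, inner_neg_left, Complex.ofReal_neg, mul_neg, midpointPhase]

theorem norm_psiDiff_le (A : RN N → RN N) (u : RN N → ℂ) (z x : RN N) :
    ‖psiDiff A u z x‖ ≤ ‖u (x + z)‖ + ‖u x‖ := by
  refine (norm_sub_le _ _).trans_eq ?_
  have hphase := norm_exp_neg_I_mul (midpointPhase A z x) 1
  rw [Complex.ofReal_one, mul_one] at hphase
  rw [Psi_self, Psi_add, norm_mul, hphase, one_mul]

theorem cdot_magGrad (A : RN N → RN N) (u : RN N → ℂ) (G : RN N → CN N) (x z : RN N) :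
    cdot (magGrad A u G x) z = cdot (G x) z - I * (inner ℝ z (A x) : ℝ) * u x := by
  simp only [cdot, magGrad, PiLp.inner_apply, RCLike.inner_apply, conj_trivial, Complex.ofReal_sum,
    Complex.ofReal_mul, Finset.mul_sum, Finset.sum_mul, ← Finset.sum_sub_distrib]
  exact Finset.sum_congr rfl fun _ _ => by ring

theorem IsWeakGradient.ae_psiDiff_eq_integral (h : IsWeakGradient u G) (A : RN N → RN N)
    (z : RN N) :
    ∀ᵐ x, psiDiff A u z x = ∫ t in Set.Ioc (0 : ℝ) 1, psiLineDeriv A u G z x t := by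
  filter_upwards [(h.hasWeakLineDeriv z).ae_exp_mul_sub_eq_integral] with x hx
  rw [psiDiff, Psi_self, Psi_add, hx, intervalIntegral.integral_of_le zero_le_one]
  rfl

theorem IsWeakGradient.ae_integrableOn_psiLineDeriv (h : IsWeakGradient u G) (A : RN N → RN N)
    (z : RN N) : ∀ᵐ x, IntegrableOn (psiLineDeriv A u G z x) (Set.Ioc 0 1) := by
  filter_upwards [ae_integrableOn_comp_add_smul h.locallyIntegrable z isCompact_Icc,
    ae_integrableOn_comp_add_smul (locallyIntegrable_cdot h.locallyIntegrable_grad z) z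
      isCompact_Icc] with x hu hG
  exact ((hG.sub (hu.const_mul _)).mono_set Set.Ioc_subset_Icc_self).bdd_mul
    (by fun_prop) (ae_of_all _ fun t => (norm_exp_neg_I_mul _ t).le)

section Lipschitz

variable {L : NNReal} (hA : LipschitzWith L A) (x z : RN N) {t : ℝ} (ht : t ∈ Set.Ioc (0 : ℝ) 1)
include hA ht

theorem abs_inner_sub_midpointPhase_le :
    |inner ℝ z (A (x + t • z)) - midpointPhase A z x| ≤ ‖z‖ * (L * ‖z‖) := by
  have hstep : x + t • z - (x + (1 / 2 : ℝ) • z) = (t - 1 / 2) • z := by module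
  have hdist : ‖A (x + t • z) - A (x + (1 / 2 : ℝ) • z)‖ ≤ L * ‖z‖ := by
    refine (hA.norm_sub_le _ _).trans (mul_le_mul_of_nonneg_left ?_ L.coe_nonneg)
    rw [hstep, norm_smul]
    exact mul_le_of_le_one_left (norm_nonneg z)
      (abs_le.2 ⟨by linarith [ht.1], by linarith [ht.2]⟩)
  rw [midpointPhase, ← inner_sub_right]
  exact (abs_real_inner_le_norm _ _).trans (mul_le_mul_of_nonneg_left hdist (norm_nonneg z))

theorem norm_sub_cdot_magGrad_le (u : RN N → ℂ) (G : RN N → CN N) :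
    ‖cdot (G (x + t • z)) z - I * midpointPhase A z x * u (x + t • z)
        - cdot (magGrad A u G (x + t • z)) z‖ ≤ ‖z‖ * (L * ‖z‖ * ‖u (x + t • z)‖) := by
  calc _ = ‖I * ((inner ℝ z (A (x + t • z)) - midpointPhase A z x : ℝ) : ℂ) * u (x + t • z)‖ := by
        rw [cdot_magGrad, Complex.ofReal_sub]
        ring_nf
    _ = |inner ℝ z (A (x + t • z)) - midpointPhase A z x| * ‖u (x + t • z)‖ := by
        rw [norm_mul, norm_mul, Complex.norm_I, one_mul, Complex.norm_real, Real.norm_eq_abs]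
    _ ≤ ‖z‖ * (L * ‖z‖) * ‖u (x + t • z)‖ := by
        gcongr
        exact abs_inner_sub_midpointPhase_le hA x z ht
    _ = _ := mul_assoc _ _ _

theorem norm_psiLineDeriv_le (u : RN N → ℂ) (G : RN N → CN N) :
    ‖psiLineDeriv A u G z x t‖
      ≤ ‖z‖ * (‖magGrad A u G (x + t • z)‖ + L * ‖z‖ * ‖u (x + t • z)‖) := by
  rw [psiLineDeriv, norm_mul, norm_exp_neg_I_mul, one_mul]
  calc _ ≤ ‖cdot (magGrad A u G (x + t • z)) z‖
        + ‖cdot (G (x + t • z)) z - I * midpointPhase A z x * u (x + t • z)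
          - cdot (magGrad A u G (x + t • z)) z‖ := norm_le_norm_add_norm_sub' _ _
    _ ≤ ‖magGrad A u G (x + t • z)‖ * ‖z‖ + ‖z‖ * (L * ‖z‖ * ‖u (x + t • z)‖) :=
        add_le_add (norm_cdot_le _ _) (norm_sub_cdot_magGrad_le hA x z ht u G)
    _ = _ := by ring

theorem norm_psiLineDeriv_sub_cdot_magGrad_le (u : RN N → ℂ) (G : RN N → CN N) :
    ‖psiLineDeriv A u G z x t - cdot (magGrad A u G x) z‖
      ≤ ‖z‖ * (‖magGrad A u G (x + t • z) - magGrad A u G x‖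
        + (‖min 2 |midpointPhase A z x| • magGrad A u G x‖ + L * ‖z‖ * ‖u (x + t • z)‖)) := by
  set V := magGrad A u G
  set s := midpointPhase A z x
  set B := cdot (G (x + t • z)) z - I * s * u (x + t • z) - cdot (V (x + t • z)) z
  set e := Complex.exp (-(I * s * t))
  have hsplit : psiLineDeriv A u G z x t - cdot (V x) z
      = e * cdot (V (x + t • z) - V x) z + (e - 1) * cdot (V x) z + e * B := by
    rw [psiLineDeriv, sub_cdot]; ring
  have hgrad : ‖e * cdot (V (x + t • z) - V x) z‖ ≤ ‖V (x + t • z) - V x‖ * ‖z‖ := by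
    rw [norm_mul, norm_exp_neg_I_mul, one_mul]
    exact norm_cdot_le _ _
  have hphase : ‖(e - 1) * cdot (V x) z‖ ≤ min 2 |s| * (‖V x‖ * ‖z‖) := by
    rw [norm_mul]
    exact mul_le_mul (norm_exp_neg_I_mul_sub_one_le s ht) (norm_cdot_le _ _) (norm_nonneg _)
      (by positivity)
  have hrest : ‖e * B‖ ≤ ‖z‖ * (L * ‖z‖ * ‖u (x + t • z)‖) := by
    rw [norm_mul, norm_exp_neg_I_mul, one_mul]
    exact norm_sub_cdot_magGrad_le hA x z ht u G
  calc ‖psiLineDeriv A u G z x t - cdot (V x) z‖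
      ≤ ‖V (x + t • z) - V x‖ * ‖z‖ + min 2 |s| * (‖V x‖ * ‖z‖)
        + ‖z‖ * (L * ‖z‖ * ‖u (x + t • z)‖) :=
        hsplit ▸ norm_add_le_of_le (norm_add_le_of_le hgrad hphase) hrest
    _ = _ := by
        rw [norm_smul, Real.norm_of_nonneg (by positivity : 0 ≤ min 2 |s|)]
        ring

end Lipschitz

theorem IsWeakGradient.ae_enorm_psiDiff_le (h : IsWeakGradient u G) {L : NNReal}
    (hA : LipschitzWith L A) (z : RN N) :
    ∀ᵐ x, ‖psiDiff A u z x‖ₑ ≤ ‖z‖ₑ * ∫⁻ t in Set.Ioc (0 : ℝ) 1,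
      (‖magGrad A u G (x + t • z)‖ₑ + L * ‖z‖ₑ * ‖u (x + t • z)‖ₑ) := by
  filter_upwards [h.ae_psiDiff_eq_integral A z] with x hx
  rw [hx, ← lintegral_const_mul' _ _ enorm_ne_top]
  refine (enorm_integral_le_lintegral_enorm _).trans (setLIntegral_mono' measurableSet_Ioc
    fun t ht => ?_)
  have := norm_psiLineDeriv_le hA x z ht u G
  simp only [enorm_eq_nnnorm]
  exact_mod_cast this

theorem IsWeakGradient.ae_enorm_psiDiff_sub_le (h : IsWeakGradient u G) {L : NNReal}
    (hA : LipschitzWith L A) (z : RN N) :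
    ∀ᵐ x, ‖psiDiff A u z x - cdot (magGrad A u G x) z‖ₑ ≤ ‖z‖ₑ * ∫⁻ t in Set.Ioc (0 : ℝ) 1,
      (‖magGrad A u G (x + t • z) - magGrad A u G x‖ₑ
        + (‖min 2 |midpointPhase A z x| • magGrad A u G x‖ₑ
        + L * ‖z‖ₑ * ‖u (x + t • z)‖ₑ)) := by
  filter_upwards [h.ae_psiDiff_eq_integral A z, h.ae_integrableOn_psiLineDeriv A z] with x hx hint
  have hmean : cdot (magGrad A u G x) z = ∫ _ in Set.Ioc (0 : ℝ) 1, cdot (magGrad A u G x) z := by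
    simp
  rw [hx, hmean, ← integral_sub hint (by simp), ← lintegral_const_mul' _ _ enorm_ne_top]
  refine (enorm_integral_le_lintegral_enorm _).trans (setLIntegral_mono' measurableSet_Ioc
    fun t ht => ?_)
  have := norm_psiLineDeriv_sub_cdot_magGrad_le hA x z ht u G
  simp only [enorm_eq_nnnorm]
  exact_mod_cast this

theorem aestronglyMeasurable_magGrad (hA : Continuous A) (hu : AEStronglyMeasurable u)
    (hG : AEStronglyMeasurable G) : AEStronglyMeasurable (magGrad A u G) := by
  have hcoord : AEMeasurable fun x j => G x j - I * ((A x j : ℝ) : ℂ) * u x := by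
    refine aemeasurable_pi_lambda _ fun j => ?_
    have := hA.measurable
    have := hu.aemeasurable
    have := hG.aemeasurable
    fun_prop
  exact ((PiLp.continuous_toLp 2 _).measurable.comp_aemeasurable hcoord).aestronglyMeasurable

theorem continuous_midpointPhase (hA : Continuous A) :
    Continuous fun q : RN N × RN N => midpointPhase A q.1 q.2 := by
  unfold midpointPhase; fun_prop

end MagneticIncrement

section LpDifferentiability

variable {N : ℕ} {A : RN N → RN N} {u : RN N → ℂ} {G : RN N → CN N} {L : NNReal} {q : ℝ≥0∞}

theorem aestronglyMeasurable_comp_add_smul_prod {F : Type*} [TopologicalSpace F] {f : RN N → F}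
    (hf : AEStronglyMeasurable f) (z : RN N) (ν : Measure ℝ) [SFinite ν] :
    AEStronglyMeasurable (fun r : RN N × ℝ => f (r.1 + r.2 • z)) (volume.prod ν) :=
  hf.comp_quasiMeasurePreserving
    (quasiMeasurePreserving_add_comp_snd (measurable_id.smul_const z))

theorem eLpNorm_comp_add_right {F : Type*} [NormedAddCommGroup F] {f : RN N → F}
    (hf : AEStronglyMeasurable f) (z : RN N) :
    eLpNorm (fun x => f (x + z)) q volume = eLpNorm f q volume :=
  eLpNorm_comp_measurePreserving hf (measurePreserving_add_right volume z)

theorem IsWeakGradient.eLpNorm_psiDiff_sub_le (h : IsWeakGradient u G) (hA : LipschitzWith L A)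
    (hq : 1 ≤ q) (hq_top : q ≠ ⊤) (hV : AEStronglyMeasurable (magGrad A u G)) (z : RN N) {ε : ℝ≥0∞}
    (hε : ∀ t ∈ Set.Ioc (0 : ℝ) 1,
      eLpNorm (fun x => magGrad A u G (x + t • z) - magGrad A u G x) q volume ≤ ε) :
    eLpNorm (fun x => psiDiff A u z x - cdot (magGrad A u G x) z) q volume
      ≤ ‖z‖ₑ * (ε + (eLpNorm (fun x => min 2 |midpointPhase A z x| • magGrad A u G x) q volume
        + L * ‖z‖ₑ * eLpNorm u q volume)) := by
  set V := magGrad A u G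
  have hu : AEStronglyMeasurable u := h.locallyIntegrable.aestronglyMeasurable
  have hcont : Continuous fun x => min 2 |midpointPhase A z x| := by
    have := continuous_midpointPhase hA.continuous
    fun_prop
  have hc := hcont.aestronglyMeasurable.smul hV
  have : IsProbabilityMeasure (volume.restrict (Set.Ioc (0 : ℝ) 1)) := ⟨by simp⟩
  let f : RN N → ℝ → ℝ≥0∞ := fun x t => ‖V (x + t • z) - V x‖ₑ
    + (‖min 2 |midpointPhase A z x| • V x‖ₑ + L * ‖z‖ₑ * ‖u (x + t • z)‖ₑ)
  refine (eLpNorm_le_nnreal_smul_eLpNorm_of_ae_le_mul' (c := ‖z‖₊)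
    (g := fun x => ∫⁻ t in Set.Ioc (0 : ℝ) 1, f x t) (h.ae_enorm_psiDiff_sub_le hA z) q).trans
    (mul_le_mul_right ?_ _)
  refine eLpNorm_lintegral_le ?_ hq hq_top
    (ae_restrict_of_forall_mem measurableSet_Ioc fun t ht => ?_)
  · exact ((aestronglyMeasurable_comp_add_smul_prod hV z _).sub hV.comp_fst).enorm.add
      (hc.comp_fst.enorm.add ((aestronglyMeasurable_comp_add_smul_prod hu z _).enorm.const_mul _))
  · have hVt := hV.comp_measurePreserving (measurePreserving_add_right volume (t • z))
    have hut := hu.comp_measurePreserving (measurePreserving_add_right volume (t • z))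
    have hLut := (hut.enorm.const_mul (L * ‖z‖ₑ)).aestronglyMeasurable
    refine (eLpNorm_add_le (hVt.sub hV).enorm.aestronglyMeasurable
      (hc.enorm.aestronglyMeasurable.add hLut) hq).trans (add_le_add ?_
      ((eLpNorm_add_le hc.enorm.aestronglyMeasurable hLut hq).trans (add_le_add ?_ ?_)))
    · exact (eLpNorm_enorm _).trans_le (hε t ht)
    · exact (eLpNorm_enorm _).le
    · refine (eLpNorm_le_nnreal_smul_eLpNorm_of_ae_le_mul' (c := L * ‖z‖₊)
        (g := fun x => u (x + t • z)) (ae_of_all _ fun x => ?_) q).trans_eq ?_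
      · simp [enorm_eq_nnnorm]
      · rw [eLpNorm_comp_add_right hu]
        simp [enorm_eq_nnnorm, ENNReal.smul_def]

theorem IsWeakGradient.eventually_eLpNorm_psiDiff_sub_le (h : IsWeakGradient u G)
    (hA : LipschitzWith L A) (hq : 1 ≤ q) (hq_top : q ≠ ⊤) (hu : MemLp u q)
    (hV : MemLp (magGrad A u G) q) {ε : ℝ≥0∞} (hε : ε ≠ 0) :
    ∀ᶠ z in 𝓝 0, eLpNorm (fun x => psiDiff A u z x - cdot (magGrad A u G x) z) q volume
      ≤ ‖z‖ₑ * ε := by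
  have hε3 : ε / 3 ≠ 0 := (ENNReal.div_pos hε (by simp)).ne'
  have hmid := continuous_midpointPhase hA.continuous
  have hphase : Tendsto (fun z => eLpNorm (fun x => min 2 |midpointPhase A z x| • magGrad A u G x)
      q volume) (𝓝 0) (𝓝 0) := by
    refine tendsto_eLpNorm_smul_zero hV hq_top (C := 2)
      (fun z => Continuous.aestronglyMeasurable (by fun_prop)) (fun z => ae_of_all _ fun x => ?_)
      (ae_of_all _ fun x => ?_)
    · rw [Real.norm_of_nonneg (by positivity)]
      exact min_le_left _ _
    · have : Continuous fun z => min 2 |midpointPhase A z x| := by fun_prop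
      simpa [midpointPhase] using this.tendsto 0
  have hrest : Tendsto (fun z : RN N => L * ‖z‖ₑ * eLpNorm u q volume) (𝓝 0) (𝓝 0) := by
    refine Continuous.tendsto' ?_ 0 0 (by simp)
    exact (ENNReal.continuous_mul_const hu.2.ne).comp
      ((ENNReal.continuous_const_mul ENNReal.coe_ne_top).comp continuous_enorm)
  obtain ⟨r, hr, hball⟩ := Metric.eventually_nhds_iff_ball.1
    (ENNReal.tendsto_nhds_zero.1 (tendsto_eLpNorm_comp_add_sub hV hq hq_top) (ε / 3)
      hε3.bot_lt)
  filter_upwards [Metric.ball_mem_nhds 0 hr, ENNReal.tendsto_nhds_zero.1 hphase _ hε3.bot_lt,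
    ENNReal.tendsto_nhds_zero.1 hrest _ hε3.bot_lt] with z hz hzphase hzrest
  have hshift (t : ℝ) (ht : t ∈ Set.Ioc (0 : ℝ) 1) : t • z ∈ Metric.ball 0 r := by
    rw [mem_ball_zero_iff] at hz ⊢
    rw [norm_smul, Real.norm_of_nonneg ht.1.le]
    exact (mul_le_of_le_one_left (norm_nonneg z) ht.2).trans_lt hz
  calc _ ≤ ‖z‖ₑ * (ε / 3 + (ε / 3 + ε / 3)) :=
        (h.eLpNorm_psiDiff_sub_le hA hq hq_top hV.1 z fun t ht => hball _ (hshift t ht)).trans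
          (by gcongr)
    _ = ‖z‖ₑ * ε := by rw [← add_assoc, ENNReal.add_thirds]

theorem IsWeakGradient.tendsto_eLpNorm_inv_smul_psiDiff_sub (h : IsWeakGradient u G)
    (hA : LipschitzWith L A) (hq : 1 ≤ q) (hq_top : q ≠ ⊤) (hu : MemLp u q)
    (hV : MemLp (magGrad A u G) q) (w : RN N) :
    Tendsto (fun δ : ℝ => eLpNorm (fun x =>
      δ⁻¹ • psiDiff A u (δ • w) x - cdot (magGrad A u G x) w) q volume) (𝓝[>] 0) (𝓝 0) := by
  have hscale (δ : ℝ) (hδ : 0 < δ) : (fun x =>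
      δ⁻¹ • psiDiff A u (δ • w) x - cdot (magGrad A u G x) w)
      = δ⁻¹ • fun x => psiDiff A u (δ • w) x - cdot (magGrad A u G x) (δ • w) := by
    ext x
    rw [Pi.smul_apply, smul_sub, cdot_smul, Complex.real_smul, Complex.real_smul,
      ← mul_assoc, ← Complex.ofReal_mul, inv_mul_cancel₀ hδ.ne',
      Complex.ofReal_one, one_mul]
  have hzero : Tendsto (fun δ : ℝ => δ • w) (𝓝[>] 0) (𝓝 0) :=
    ((continuous_id.smul continuous_const).tendsto' 0 0 (zero_smul ℝ w)).mono_left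
      nhdsWithin_le_nhds
  refine ENNReal.tendsto_nhds_zero.2 fun ε hε => ?_
  have hεw : ε / ‖w‖ₑ ≠ 0 := (ENNReal.div_pos hε.ne' enorm_ne_top).ne'
  filter_upwards [self_mem_nhdsWithin,
    hzero.eventually (h.eventually_eLpNorm_psiDiff_sub_le hA hq hq_top hu hV hεw)] with δ hδ hbound
  have hδ0 : ‖δ‖ₑ ≠ 0 := enorm_ne_zero.2 (ne_of_gt hδ)
  rw [hscale δ hδ, eLpNorm_const_smul, enorm_inv (ne_of_gt hδ)]
  calc _ ≤ ‖δ‖ₑ⁻¹ * (‖δ‖ₑ * (‖w‖ₑ * (ε / ‖w‖ₑ))) := by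
        rw [← mul_assoc ‖δ‖ₑ, ← enorm_smul]
        gcongr
    _ = ‖w‖ₑ * (ε / ‖w‖ₑ) := by
        rw [← mul_assoc, ENNReal.inv_mul_cancel hδ0 enorm_ne_top, one_mul]
    _ ≤ ε := ENNReal.mul_div_le

end LpDifferentiability

section Sections

variable {X Y : Type*} [MeasurableSpace X] [MeasurableSpace Y] {μ : Measure X} {ν : Measure Y}
  {S : Set (X × Y)} {k : X → ℝ≥0∞}

theorem ae_nullMeasurableSet_section [SFinite ν] (hS : NullMeasurableSet S (μ.prod ν)) :
    ∀ᵐ x ∂μ, NullMeasurableSet {y | (x, y) ∈ S} ν := by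
  have h := ((aemeasurable_indicator_const_iff (1 : ℝ≥0∞)).2 hS).aestronglyMeasurable.prodMk_left
  filter_upwards [h] with x hx
  exact (aemeasurable_indicator_const_iff (1 : ℝ≥0∞)).1 hx.aemeasurable

theorem aemeasurable_measure_section [SFinite ν] (hS : NullMeasurableSet S (μ.prod ν)) :
    AEMeasurable (fun x => ν {y | (x, y) ∈ S}) μ := by
  refine ((aemeasurable_indicator_const_iff (1 : ℝ≥0∞)).2 hS).lintegral_prod_right'.congr ?_
  filter_upwards [ae_nullMeasurableSet_section hS] with x hx
  exact lintegral_indicator_one₀ hx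

theorem lintegral_indicator_comp_fst [SFinite ν] (hS : NullMeasurableSet S (μ.prod ν))
    (hk : AEMeasurable k μ) :
    ∫⁻ q, S.indicator (fun q => k q.1) q ∂μ.prod ν = ∫⁻ x, k x * ν {y | (x, y) ∈ S} ∂μ := by
  rw [lintegral_prod _ (hk.comp_fst.indicator₀ hS)]
  refine lintegral_congr_ae ?_
  filter_upwards [ae_nullMeasurableSet_section hS] with x hx
  exact lintegral_indicator_const₀ hx (k x)

theorem lintegral_indicator_comp_fst_symm [SFinite μ] [SFinite ν]
    (hS : NullMeasurableSet S (μ.prod ν)) (hk : AEMeasurable k μ) :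
    ∫⁻ q, S.indicator (fun q => k q.1) q ∂μ.prod ν
      = ∫⁻ y, ∫⁻ x in {x | (x, y) ∈ S}, k x ∂μ ∂ν := by
  rw [lintegral_prod_symm _ (hk.comp_fst.indicator₀ hS)]
  refine lintegral_congr_ae ?_
  filter_upwards [ae_nullMeasurableSet_section
    (hS.preimage Measure.measurePreserving_swap.quasiMeasurePreserving)] with y hy
  exact lintegral_indicator₀ hy k

end Sections

section Superlevel

variable {N : ℕ} {p : ℝ} {K : Set (RN N)}

theorem IsNormUnitBall.memLp_of_lintegral_momentNorm_lt_top (hK : IsNormUnitBall K) (hp : 0 < p)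
    {X : Type*} [MeasurableSpace X] {μ : Measure X} {V : X → CN N} (hV : AEStronglyMeasurable V μ)
    (hfin : ∫⁻ x, ENNReal.ofReal (momentNorm p K (V x) ^ p) ∂μ < ⊤) :
    MemLp V (ENNReal.ofReal p) μ := by
  obtain ⟨C, hC⟩ := hK.exists_norm_le_mul_momentNorm hp
  have hnonneg (v : CN N) : 0 ≤ momentNorm p K v := momentNorm_nonneg hp v
  have hmoment : MemLp (fun x => momentNorm p K (V x)) (ENNReal.ofReal p) μ := by
    refine ⟨(hK.continuous_momentNorm hp).comp_aestronglyMeasurable hV, ?_⟩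
    rw [eLpNorm_lt_top_iff_lintegral_rpow_enorm_lt_top (by simpa using hp) ENNReal.ofReal_ne_top,
      ENNReal.toReal_ofReal hp.le]
    simpa only [Real.enorm_of_nonneg (hnonneg _), ENNReal.ofReal_rpow_of_nonneg (hnonneg _) hp.le]
      using hfin
  exact hmoment.of_le_mul hV (ae_of_all _ fun x => by
    simpa only [Real.norm_of_nonneg (hnonneg _)] using hC (V x))

theorem aemeasurable_absP_cdot_prod (hp : 0 < p) {X : Type*} [MeasurableSpace X] {μ : Measure X}
    {V : X → CN N} (hV : AEStronglyMeasurable V μ) :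
    AEMeasurable (fun q : RN N × X => absP p (cdot (V q.2) q.1)) (volume.prod μ) :=
  ((continuous_absP_cdot hp).comp_aestronglyMeasurable
    (hV.comp_snd.prodMk measurable_fst.aestronglyMeasurable)).aemeasurable

theorem ae_measure_absP_cdot_eq_one_eq_zero (hp : 0 < p) {X : Type*} [MeasurableSpace X]
    {μ : Measure X} [SFinite μ] {V : X → CN N} (hV : AEStronglyMeasurable V μ) :
    ∀ᵐ w : RN N, μ {x | absP p (cdot (V x) w) = 1} = 0 := by
  have hS : NullMeasurableSet {q : RN N × X | absP p (cdot (V q.2) q.1) = 1} (volume.prod μ) :=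
    nullMeasurableSet_eq_fun (aemeasurable_absP_cdot_prod hp hV) aemeasurable_const
  have hslice (v : CN N) : volume {w : RN N | absP p (cdot v w) = 1} = 0 := by
    refine measure_levelSet_eq_zero_of_homogeneous
      ((continuous_absP_cdot hp).comp (Continuous.prodMk_right v)).measurable
      (fun r x hr => ?_) one_pos
    simp only [Function.comp_apply, cdot_smul, absP_ofReal_mul hp, abs_of_pos hr]
  have hnull : volume.prod μ {q : RN N × X | absP p (cdot (V q.2) q.1) = 1} = 0 := by
    rw [← lintegral_indicator_one₀ hS]
    refine (lintegral_indicator_comp_fst_symm hS (k := 1) aemeasurable_const).trans ?_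
    simp [hslice]
  exact Measure.measure_ae_null_of_prod_null hnull

theorem lintegral_gaugeKernel_mul_measure_absP_cdot (hK : IsNormUnitBall K) (hp : 0 < p) {X : Type*}
    [MeasurableSpace X] {μ : Measure X} [SFinite μ] {V : X → CN N} (hV : AEStronglyMeasurable V μ) :
    ∫⁻ w, gaugeKernel p K w * μ {x | 1 < absP p (cdot (V x) w)}
      = ∫⁻ x, ENNReal.ofReal (momentNorm p K (V x) ^ p) ∂μ := by
  have hS : NullMeasurableSet {q : RN N × X | 1 < absP p (cdot (V q.2) q.1)} (volume.prod μ) :=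
    nullMeasurableSet_lt aemeasurable_const (aemeasurable_absP_cdot_prod hp hV)
  have hk := (measurable_gaugeKernel (p := p) hK.convex hK.mem_nhds).aemeasurable (μ := volume)
  refine (lintegral_indicator_comp_fst hS hk).symm.trans
    ((lintegral_indicator_comp_fst_symm hS hk).trans ?_)
  exact lintegral_congr fun x => hK.setLIntegral_gaugeKernel_absP_cdot hp (V x)

variable {A : RN N → RN N} {u : RN N → ℂ} {G : RN N → CN N} {L : NNReal}

theorem aestronglyMeasurable_psiDiff (hA : Continuous A) (hu : AEStronglyMeasurable u)
    (z : RN N) : AEStronglyMeasurable (psiDiff A u z) := by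
  have huz := hu.comp_measurePreserving (measurePreserving_add_right volume z)
  have hmid := continuous_midpointPhase hA
  unfold psiDiff
  simp_rw [Psi_self, Psi_add]
  exact ((Continuous.aestronglyMeasurable (by fun_prop)).mul huz).sub hu

theorem memLp_absP_cdot (hp : 1 ≤ p) {q : ℝ≥0∞} {X : Type*} [MeasurableSpace X] {μ : Measure X}
    {V : X → CN N} (hV : MemLp V q μ) (w : RN N) : MemLp (fun x => absP p (cdot (V x) w)) q μ := by
  have hc := (continuous_absP_cdot (N := N) (one_pos.trans_le hp)).comp (Continuous.prodMk_left w)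
  refine hV.of_le_mul (c := 2 * ‖w‖) (hc.comp_aestronglyMeasurable hV.1) (ae_of_all _ fun x => ?_)
  rw [Real.norm_of_nonneg (absP_nonneg _ _), mul_assoc, mul_comm ‖w‖]
  exact (absP_le_two_mul_norm hp _).trans (by gcongr; exact norm_cdot_le _ _)

theorem IsWeakGradient.tendstoInMeasure_absP_inv_smul_psiDiff (h : IsWeakGradient u G)
    (hA : LipschitzWith L A) (hp : 1 ≤ p) {q : ℝ≥0∞} (hq : 1 ≤ q) (hq_top : q ≠ ⊤) (hu : MemLp u q)
    (hV : MemLp (magGrad A u G) q) (w : RN N) :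
    TendstoInMeasure volume (fun (δ : ℝ) x => absP p (δ⁻¹ • psiDiff A u (δ • w) x)) (𝓝[>] 0)
      fun x => absP p (cdot (magGrad A u G x) w) := by
  have hψ (δ : ℝ) : AEStronglyMeasurable fun x => δ⁻¹ • psiDiff A u (δ • w) x :=
    (aestronglyMeasurable_psiDiff hA.continuous hu.1 _).fun_const_smul _
  have hbound (δ : ℝ) : eLpNorm (fun x =>
      absP p (δ⁻¹ • psiDiff A u (δ • w) x) - absP p (cdot (magGrad A u G x) w)) q volume
      ≤ 2 * eLpNorm (fun x =>
        δ⁻¹ • psiDiff A u (δ • w) x - cdot (magGrad A u G x) w) q volume :=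
    eLpNorm_le_nnreal_smul_eLpNorm_of_ae_le_mul (c := 2)
      (ae_of_all _ fun x => abs_absP_sub_absP_le hp _ _) q
  refine tendstoInMeasure_of_tendsto_eLpNorm (one_pos.trans_le hq).ne'
    (fun δ => (continuous_absP (one_pos.trans_le hp)).comp_aestronglyMeasurable (hψ δ))
    (memLp_absP_cdot hp hV w).1 ?_
  refine tendsto_of_tendsto_of_tendsto_of_le_of_le tendsto_const_nhds ?_ (fun _ => zero_le) hbound
  simpa using ENNReal.Tendsto.const_mul (a := 2)
    (h.tendsto_eLpNorm_inv_smul_psiDiff_sub hA hq hq_top hu hV w) (.inr (by simp))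

theorem IsWeakGradient.tendsto_measure_lt_absP_psiDiff (h : IsWeakGradient u G)
    (hA : LipschitzWith L A) (hp : 1 ≤ p) {q : ℝ≥0∞} (hq : 1 ≤ q) (hq_top : q ≠ ⊤) (hu : MemLp u q)
    (hV : MemLp (magGrad A u G) q) {w : RN N}
    (hw : volume {x | absP p (cdot (magGrad A u G x) w) = 1} = 0) :
    Tendsto (fun δ : ℝ => volume {x | δ < absP p (psiDiff A u (δ • w) x)}) (𝓝[>] 0)
      (𝓝 (volume {x | 1 < absP p (cdot (magGrad A u G x) w)})) := by
  have hlim := memLp_absP_cdot hp hV w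
  have hfin : volume {x | 1 / 2 < absP p (cdot (magGrad A u G x) w)} ≠ ⊤ := by
    refine ne_top_of_le_ne_top (hlim.meas_ge_lt_top (one_pos.trans_le hq).ne' hq_top
      (ε := 1 / 2) (by simp)).ne (measure_mono
      fun x (hx : 1 / 2 < absP p (cdot (magGrad A u G x) w)) => ?_)
    rw [Set.mem_ofPred_eq, ← NNReal.coe_le_coe, coe_nnnorm, Real.norm_of_nonneg (absP_nonneg _ _)]
    exact hx.le
  refine (tendsto_measure_lt_of_tendstoInMeasure
    (h.tendstoInMeasure_absP_inv_smul_psiDiff hA hp hq hq_top hu hV w) hlim.1.aemeasurable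
    one_half_lt_one hfin hw).congr' ?_
  filter_upwards [self_mem_nhdsWithin] with δ (hδ : 0 < δ)
  congr 1 with x
  rw [Set.mem_ofPred_eq, Set.mem_ofPred_eq, Complex.real_smul,
    absP_ofReal_mul (one_pos.trans_le hp), abs_of_pos (inv_pos.2 hδ), ← div_eq_inv_mul,
    one_lt_div hδ]

end Superlevel

section Domination

variable {N : ℕ} {p : ℝ} {A : RN N → RN N} {u : RN N → ℂ} {G : RN N → CN N} {L : NNReal}

theorem measure_one_lt_le {X : Type*} [MeasurableSpace X] {μ : Measure X} {f : X → ℝ≥0∞}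
    (hf : AEMeasurable f μ) : μ {x | 1 < f x} ≤ ∫⁻ x, aboveOne (f x) ∂μ := by
  have hsub : {x | 1 < f x} ⊆ {x | 1 ≤ aboveOne (f x)} := fun x (hx : 1 < f x) => by
    simpa [aboveOne, hx] using hx.le
  refine (measure_mono hsub).trans ?_
  simpa using mul_meas_ge_le_lintegral₀ (measurable_aboveOne.comp_aemeasurable hf) 1

/-- The function `|∇u - iAu| + (L + 1) |u|`, where `L` is the Lipschitz constant of `A`. It controls
the increments `psiDiff` of all sizes: those of size at most one through its averages along
segments, the others through its values at the end points. -/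
def incrementMajorant (A : RN N → RN N) (u : RN N → ℂ) (G : RN N → CN N) (L : NNReal)
    (x : RN N) : ℝ≥0∞ :=
  ‖magGrad A u G x‖ₑ + (L + 1) * ‖u x‖ₑ

theorem aemeasurable_incrementMajorant (hu : AEStronglyMeasurable u)
    (hV : AEStronglyMeasurable (magGrad A u G)) : AEMeasurable (incrementMajorant A u G L) :=
  hV.enorm.add (hu.enorm.const_mul _)

theorem lintegral_incrementMajorant_rpow_ne_top (hp : 0 < p) (hu : MemLp u (ENNReal.ofReal p))
    (hV : MemLp (magGrad A u G) (ENNReal.ofReal p)) :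
    ∫⁻ x, (4 * incrementMajorant A u G L x) ^ p ≠ ⊤ := by
  have hF : MemLp (fun x => (4 : ℝ) * (‖magGrad A u G x‖ + (L + 1) * ‖u x‖)) (ENNReal.ofReal p) :=
    (hV.norm.add (hu.norm.const_mul _)).const_mul _
  have hint := lintegral_rpow_enorm_lt_top_of_eLpNorm_lt_top (by simpa using hp)
    ENNReal.ofReal_ne_top hF.2
  rw [ENNReal.toReal_ofReal hp.le] at hint
  refine (lt_of_eq_of_lt (lintegral_congr fun x => ?_) hint).ne
  congr 1
  have hnn : ‖(4 : ℝ) * (‖magGrad A u G x‖ + (L + 1) * ‖u x‖)‖₊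
      = 4 * (‖magGrad A u G x‖₊ + (L + 1) * ‖u x‖₊) := by
    ext
    simpa using by positivity
  rw [incrementMajorant, enorm_eq_nnnorm, enorm_eq_nnnorm, enorm_eq_nnnorm, hnn]
  push_cast
  rfl

theorem ofReal_lt_two_mul_enorm_of_lt_absP (hp : 1 ≤ p) {δ : ℝ} (hδ : 0 ≤ δ) {z : ℂ}
    (h : δ < absP p z) : ENNReal.ofReal δ < 2 * ‖z‖ₑ := by
  have hlt : δ < 2 * ‖z‖ := h.trans_le (absP_le_two_mul_norm hp z)
  calc ENNReal.ofReal δ < ENNReal.ofReal (2 * ‖z‖) :=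
        (ENNReal.ofReal_lt_ofReal_iff_of_nonneg hδ).2 hlt
    _ = 2 * ‖z‖ₑ := by rw [ENNReal.ofReal_mul zero_le_two, ENNReal.ofReal_ofNat, ofReal_norm]

theorem one_lt_two_mul_enorm_mul {δ : ℝ} (hδ : 0 < δ) {w : RN N} {a b : ℝ≥0∞}
    (h : ENNReal.ofReal δ < 2 * a) (hab : a ≤ ‖δ • w‖ₑ * b) : 1 < 2 * (‖w‖ₑ * b) := by
  have hδ0 : ENNReal.ofReal δ ≠ 0 := by simpa using hδ
  refine (ENNReal.mul_lt_mul_iff_right hδ0 ENNReal.ofReal_ne_top).1 ?_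
  calc ENNReal.ofReal δ * 1 < 2 * a := by rwa [mul_one]
    _ ≤ 2 * (‖δ • w‖ₑ * b) := by gcongr
    _ = ENNReal.ofReal δ * (2 * (‖w‖ₑ * b)) := by
        rw [enorm_smul, Real.enorm_of_nonneg hδ.le]
        ring

theorem IsWeakGradient.measure_lt_absP_psiDiff_le_of_norm_le_one (h : IsWeakGradient u G)
    (hA : LipschitzWith L A) (hp : 1 ≤ p) (hV : AEStronglyMeasurable (magGrad A u G)) {δ : ℝ}
    (hδ : 0 < δ) {w : RN N} (hw : ‖δ • w‖ₑ ≤ 1) :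
    volume {x | δ < absP p (psiDiff A u (δ • w) x)}
      ≤ ∫⁻ x, aboveOne (‖w‖ₑ * (4 * incrementMajorant A u G L x)) := by
  set F := incrementMajorant A u G L
  have hF : AEMeasurable F :=
    aemeasurable_incrementMajorant h.locallyIntegrable.aestronglyMeasurable hV
  have : IsProbabilityMeasure (volume.restrict (Set.Ioc (0 : ℝ) 1)) := ⟨by simp⟩
  have hmono : ∀ᵐ x, δ < absP p (psiDiff A u (δ • w) x) →
      2 < ∫⁻ t in Set.Ioc (0 : ℝ) 1, ‖w‖ₑ * (4 * F (x + t • δ • w)) := by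
    filter_upwards [h.ae_enorm_psiDiff_le hA (δ • w)] with x hx hlt
    have hbound : ‖psiDiff A u (δ • w) x‖ₑ
        ≤ ‖δ • w‖ₑ * ∫⁻ t in Set.Ioc (0 : ℝ) 1, F (x + t • δ • w) := by
      refine hx.trans (mul_le_mul_right (lintegral_mono fun t => add_le_add_right ?_ _) _)
      gcongr
      exact (mul_le_of_le_one_right' hw).trans le_self_add
    have h1 := one_lt_two_mul_enorm_mul hδ (ofReal_lt_two_mul_enorm_of_lt_absP hp hδ.le hlt) hbound
    rw [lintegral_const_mul' _ _ enorm_ne_top, lintegral_const_mul' _ _ (by simp)]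
    calc (2 : ℝ≥0∞) = 2 * 1 := (mul_one 2).symm
      _ < 2 * (2 * (‖w‖ₑ * ∫⁻ t in Set.Ioc (0 : ℝ) 1, F (x + t • δ • w))) :=
        (ENNReal.mul_lt_mul_iff_right two_ne_zero ENNReal.ofNat_ne_top).2 h1
      _ = _ := by ring
  calc volume {x | δ < absP p (psiDiff A u (δ • w) x)}
      ≤ volume {x | 2 < ∫⁻ t in Set.Ioc (0 : ℝ) 1, ‖w‖ₑ * (4 * F (x + t • δ • w))} :=
        measure_mono_ae hmono
    _ ≤ ∫⁻ t in Set.Ioc (0 : ℝ) 1, ∫⁻ x, aboveOne (‖w‖ₑ * (4 * F (x + t • δ • w))) :=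
        measure_two_lt_lintegral_le (((aestronglyMeasurable_comp_add_smul_prod
          hF.aestronglyMeasurable _ _).aemeasurable.const_mul 4).const_mul _)
    _ = ∫⁻ x, aboveOne (‖w‖ₑ * (4 * F x)) := by
        simp_rw [lintegral_add_right_eq_self fun x => aboveOne (‖w‖ₑ * (4 * F x))]
        simp

theorem measure_lt_absP_psiDiff_le_of_one_le_norm (hp : 1 ≤ p) (hu : AEStronglyMeasurable u)
    (hV : AEStronglyMeasurable (magGrad A u G)) {δ : ℝ} (hδ : 0 < δ) {w : RN N}
    (hw : 1 ≤ ‖δ • w‖ₑ) :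
    volume {x | δ < absP p (psiDiff A u (δ • w) x)}
      ≤ 2 * ∫⁻ x, aboveOne (‖w‖ₑ * (4 * incrementMajorant A u G L x)) := by
  set F := incrementMajorant A u G L
  have hF : AEMeasurable fun x => ‖w‖ₑ * (4 * F x) :=
    ((aemeasurable_incrementMajorant hu hV).const_mul _).const_mul _
  have huF (x : RN N) : ‖u x‖ₑ ≤ F x :=
    (le_mul_of_one_le_left' le_add_self).trans le_add_self
  have hsub : {x | δ < absP p (psiDiff A u (δ • w) x)}
      ⊆ {x | 1 < ‖w‖ₑ * (4 * F (x + δ • w))} ∪ {x | 1 < ‖w‖ₑ * (4 * F x)} := by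
    intro x hx
    have hbound : ‖psiDiff A u (δ • w) x‖ₑ ≤ ‖δ • w‖ₑ * (F (x + δ • w) + F x) := by
      refine le_mul_of_one_le_of_le hw (le_trans ?_ (add_le_add (huF _) (huF _)))
      simp only [enorm_eq_nnnorm]
      exact_mod_cast norm_psiDiff_le A u (δ • w) x
    have h1 := one_lt_two_mul_enorm_mul hδ (ofReal_lt_two_mul_enorm_of_lt_absP hp hδ.le hx) hbound
    by_contra hnot
    simp only [Set.mem_union, Set.mem_ofPred_eq, not_or, not_lt] at hnot
    have h2 : 2 * (2 * (‖w‖ₑ * (F (x + δ • w) + F x))) ≤ 2 * 1 :=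
      calc _ = ‖w‖ₑ * (4 * F (x + δ • w)) + ‖w‖ₑ * (4 * F x) := by ring
        _ ≤ 1 + 1 := add_le_add hnot.1 hnot.2
        _ = 2 * 1 := by norm_num
    exact ((ENNReal.mul_lt_mul_iff_right two_ne_zero ENNReal.ofNat_ne_top).2 h1).not_ge h2
  calc volume {x | δ < absP p (psiDiff A u (δ • w) x)}
      ≤ volume {x | 1 < ‖w‖ₑ * (4 * F (x + δ • w))} + volume {x | 1 < ‖w‖ₑ * (4 * F x)} :=
        (measure_mono hsub).trans (measure_union_le _ _)
    _ = 2 * volume {x | 1 < ‖w‖ₑ * (4 * F x)} := by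
        rw [two_mul]
        congr 1
        exact measure_preimage_add_right volume (δ • w) {x | 1 < ‖w‖ₑ * (4 * F x)}
    _ ≤ 2 * ∫⁻ x, aboveOne (‖w‖ₑ * (4 * F x)) := by
        gcongr
        exact measure_one_lt_le hF

theorem IsWeakGradient.measure_lt_absP_psiDiff_le (h : IsWeakGradient u G)
    (hA : LipschitzWith L A) (hp : 1 ≤ p) (hV : AEStronglyMeasurable (magGrad A u G)) {δ : ℝ}
    (hδ : 0 < δ) (w : RN N) :
    volume {x | δ < absP p (psiDiff A u (δ • w) x)}
      ≤ 2 * ∫⁻ x, aboveOne (‖w‖ₑ * (4 * incrementMajorant A u G L x)) := by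
  rcases le_total ‖δ • w‖ₑ 1 with hw | hw
  · exact (h.measure_lt_absP_psiDiff_le_of_norm_le_one hA hp hV hδ hw).trans
      (le_mul_of_one_le_left' one_le_two)
  · exact measure_lt_absP_psiDiff_le_of_one_le_norm hp h.locallyIntegrable.aestronglyMeasurable hV
      hδ hw

end Domination

section Limit

variable {N : ℕ} {p : ℝ} {K : Set (RN N)} {A : RN N → RN N} {u : RN N → ℂ} {G : RN N → CN N}

theorem measurePreserving_snd_add :
    MeasurePreserving (fun q : RN N × RN N => (q.2, q.1 + q.2)) :=
  Measure.measurePreserving_swap.comp (measurePreserving_add_comp_snd measurable_id)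

theorem nullMeasurableSet_lt_absP_Psi_sub (hA : Continuous A) (hu : AEStronglyMeasurable u)
    (hp : 0 < p) (δ : ℝ) :
    NullMeasurableSet {q : RN N × RN N | δ < absP p (Psi A u q.1 q.2 - Psi A u q.1 q.1)} := by
  have hphase : Continuous fun q : RN N × RN N =>
      Complex.exp (Complex.I * (inner ℝ (q.1 - q.2) (A ((1 / 2 : ℝ) • (q.1 + q.2))) : ℝ)) := by
    fun_prop
  have hdiff : AEStronglyMeasurable fun q : RN N × RN N => Psi A u q.1 q.2 - Psi A u q.1 q.1 := by
    simp_rw [Psi_self]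
    exact (hphase.aestronglyMeasurable.mul hu.comp_snd).sub hu.comp_fst
  exact nullMeasurableSet_lt aemeasurable_const
    ((continuous_absP hp).comp_aestronglyMeasurable hdiff).aemeasurable

theorem nullMeasurableSet_lt_absP_psiDiff (hA : Continuous A) (hu : AEStronglyMeasurable u)
    (hp : 0 < p) (δ : ℝ) :
    NullMeasurableSet {q : RN N × RN N | δ < absP p (psiDiff A u q.1 q.2)} := by
  convert (nullMeasurableSet_lt_absP_Psi_sub hA hu hp δ).preimage
    measurePreserving_snd_add.quasiMeasurePreserving using 1
  ext q
  simp only [psiDiff, Set.mem_preimage, Set.mem_ofPred_eq, add_comm q.2]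

theorem IsNormUnitBall.ofReal_div_gauge_rpow (hK : IsNormUnitBall K) {δ : ℝ} (hδ : 0 < δ)
    (x z : RN N) : ENNReal.ofReal (δ ^ p / gauge K (x - (z + x)) ^ ((N : ℝ) + p))
      = ENNReal.ofReal (δ ^ p) * gaugeKernel p K z := by
  rw [sub_add_cancel_right, hK.gauge_neg, gaugeKernel, finrank_euclideanSpace_fin,
    ← ENNReal.ofReal_mul (by positivity), Real.inv_rpow (gauge_nonneg z), div_eq_mul_inv]

theorem IsNormUnitBall.nonlocalFunctional_eq_lintegral_gaugeKernel (hK : IsNormUnitBall K)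
    (hA : Continuous A) (hu : AEStronglyMeasurable u) (hp : 0 < p) {δ : ℝ} (hδ : 0 < δ) :
    nonlocalFunctional p K A u δ
      = ∫⁻ w, gaugeKernel p K w * volume {x | δ < absP p (psiDiff A u (δ • w) x)} := by
  set S := {q : RN N × RN N | δ < absP p (Psi A u q.1 q.2 - Psi A u q.1 q.1)}
  have hk := measurable_gaugeKernel (p := p) hK.convex hK.mem_nhds
  have hg : Measurable (gauge K) := (continuous_gauge hK.convex hK.mem_nhds).measurable
  have hf : AEMeasurable (S.indicator fun q : RN N × RN N =>
      ENNReal.ofReal (δ ^ p / gauge K (q.1 - q.2) ^ ((N : ℝ) + p))) (volume.prod volume) :=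
    AEMeasurable.indicator₀ (by fun_prop) (nullMeasurableSet_lt_absP_Psi_sub hA hu hp δ)
  calc nonlocalFunctional p K A u δ
      = ∫⁻ q : RN N × RN N, S.indicator (fun q : RN N × RN N =>
          ENNReal.ofReal (δ ^ p / gauge K (q.1 - q.2) ^ ((N : ℝ) + p))) (q.2, q.1 + q.2) := by
        have hT := measurePreserving_snd_add (N := N)
        rw [← lintegral_map' (by rwa [hT.map_eq]) hT.measurable.aemeasurable, hT.map_eq]
        rfl
    _ = ∫⁻ q : RN N × RN N, Set.indicator {q | δ < absP p (psiDiff A u q.1 q.2)}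
          (fun q => ENNReal.ofReal (δ ^ p) * gaugeKernel p K q.1) q := by
        refine lintegral_congr fun q => ?_
        simp only [Set.indicator_apply, S, Set.mem_ofPred_eq, psiDiff, add_comm q.2,
          hK.ofReal_div_gauge_rpow hδ]
    _ = ∫⁻ z, ENNReal.ofReal (δ ^ p) * gaugeKernel p K z
          * volume {x | δ < absP p (psiDiff A u z x)} :=
        lintegral_indicator_comp_fst (nullMeasurableSet_lt_absP_psiDiff hA hu hp δ)
          (hk.const_mul _).aemeasurable
    _ = ENNReal.ofReal (δ ^ p)
          * ∫⁻ z, gaugeKernel p K z * volume {x | δ < absP p (psiDiff A u z x)} := by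
        simp_rw [mul_assoc]
        exact lintegral_const_mul' _ _ ENNReal.ofReal_ne_top
    _ = _ := (lintegral_gaugeKernel_mul_comp_smul
        (fun z => volume {x | δ < absP p (psiDiff A u z x)}) hδ).symm

theorem IsWeakGradient.tendsto_nonlocalFunctional {L : NNReal} (h : IsWeakGradient u G)
    (hK : IsNormUnitBall K) (hA : LipschitzWith L A) (hp : 1 < p)
    (hu : MemLp u (ENNReal.ofReal p)) (hV : MemLp (magGrad A u G) (ENNReal.ofReal p)) :
    Tendsto (nonlocalFunctional p K A u) (𝓝[>] 0) (𝓝 (magEnergy p K A u G)) := by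
  have hp0 : 0 < p := one_pos.trans hp
  have hk := measurable_gaugeKernel (p := p) hK.convex hK.mem_nhds
  have hmeas (δ : ℝ) (hδ : 0 < δ) : AEMeasurable fun w =>
      gaugeKernel p K w * volume {x | δ < absP p (psiDiff A u (δ • w) x)} :=
    hk.aemeasurable.mul ((aemeasurable_measure_section
      (nullMeasurableSet_lt_absP_psiDiff hA.continuous hu.1 hp0 δ)).comp_quasiMeasurePreserving
        (Measure.quasiMeasurePreserving_smul _ hδ.ne'))
  have hfin : ∫⁻ w, gaugeKernel p K w
      * (2 * ∫⁻ x, aboveOne (‖w‖ₑ * (4 * incrementMajorant A u G L x))) ≠ ⊤ := by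
    simp_rw [mul_left_comm _ (2 : ℝ≥0∞)]
    rw [lintegral_const_mul' _ _ ENNReal.ofNat_ne_top]
    refine ENNReal.mul_ne_top ENNReal.ofNat_ne_top (LT.lt.ne ?_)
    exact lintegral_gaugeKernel_mul_lintegral_aboveOne_lt_top hK.convex hK.bounded hK.mem_nhds hp
      ((aemeasurable_incrementMajorant hu.1 hV.1).const_mul 4)
      (lintegral_incrementMajorant_rpow_ne_top hp0 hu hV)
  rw [magEnergy, ← lintegral_gaugeKernel_mul_measure_absP_cdot hK hp0 hV.1]
  refine (tendsto_lintegral_filter_of_dominated_convergence' (l := 𝓝[>] 0) _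
    (eventually_mem_nhdsWithin.mono hmeas) ?_ hfin ?_).congr' ?_
  · filter_upwards [self_mem_nhdsWithin] with δ hδ
    refine ae_of_all _ fun w => ?_
    gcongr
    exact h.measure_lt_absP_psiDiff_le hA hp.le hV.1 hδ w
  · filter_upwards [ae_measure_absP_cdot_eq_one_eq_zero hp0 hV.1] with w hw
    refine ENNReal.Tendsto.const_mul (h.tendsto_measure_lt_absP_psiDiff hA hp.le
      (ENNReal.one_le_ofReal.2 hp.le) ENNReal.ofReal_ne_top hu hV hw) (.inr ENNReal.ofReal_ne_top)
  · filter_upwards [self_mem_nhdsWithin] with δ hδ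
    exact (hK.nonlocalFunctional_eq_lintegral_gaugeKernel hA.continuous hu.1 hp0 hδ).symm

end Limit

end AnisoMagnetic

end

theorem theorem1 (N : ℕ) (hN : 1 ≤ N) (p : ℝ) (hp : 1 < p)
    (K : Set (AnisoMagnetic.RN N)) (hK : AnisoMagnetic.IsNormUnitBall K)
    (A : AnisoMagnetic.RN N → AnisoMagnetic.RN N) (hA : ∃ L : NNReal, LipschitzWith L A)
    (u : AnisoMagnetic.RN N → ℂ) (hu : AnisoMagnetic.MemMagSobolev p K A u)
    (gradu : AnisoMagnetic.RN N → AnisoMagnetic.CN N)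
    (hgradu : AnisoMagnetic.IsWeakGradient u gradu) :
    Tendsto (fun δ : ℝ => AnisoMagnetic.nonlocalFunctional p K A u δ) (𝓝[>] 0)
      (𝓝 (AnisoMagnetic.magEnergy p K A u gradu)) := by
  obtain ⟨L, hL⟩ := hA
  obtain ⟨G, hG, hfin⟩ := hu.exists_grad
  have hG_meas : AEStronglyMeasurable (AnisoMagnetic.magGrad A u G) :=
    AnisoMagnetic.aestronglyMeasurable_magGrad hL.continuous hu.memLp.1
      hG.locallyIntegrable_grad.aestronglyMeasurable
  have hG_memLp : MemLp (AnisoMagnetic.magGrad A u G) (ENNReal.ofReal p) :=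
    hK.memLp_of_lintegral_momentNorm_lt_top (one_pos.trans hp) hG_meas hfin
  have hV_eq : AnisoMagnetic.magGrad A u G =ᵐ[volume] AnisoMagnetic.magGrad A u gradu := by
    filter_upwards [hG.ae_eq hgradu] with x hx
    simp only [AnisoMagnetic.magGrad, hx]
  exact hgradu.tendsto_nonlocalFunctional hK hL hp hu.memLp (hG_memLp.ae_eq hV_eq)
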